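/- Let $\mathfrak M$ be a complex Hilbert space; a linear relation in $\mathfrak M$ is a linear subspace of $\mathfrak M\times\mathfrak M$, bounded operators are identified with their graphs, and inverses, sums and scalar multiples are those of linear relations: $A^{-1}=\{\{f',f\}:\{f,f'\}\in A\}$, $A+B=\{\{f,g+k\}:\{f,g\}\in A,\{f,k\}\in B\}$, $cA=\{\{f,cf'\}:\{f,f'\}\in A\}$. A *Nevanlinna family* is a family $\mathcal M(\lambda)$, $\lambda\in\mathbb C\setminus\mathbb R$, of linear relations in $\mathfrak M$ such that $\mathcal M(\lambda)$ is maximal dissipative ($\operatorname{Im}(f',f)\ge0$ for $\{f,f'\}\in\mathcal M(\lambda)$) for $\lambda\in\mathbb C_+$ and maximal accumulative for $\lambda\in\mathbb C_-$; $\mathcal M(\lambda)^*=\mathcal M(\bar\lambda)$; and for some $\mu\in\mathbb C_+$ (resp. $\mathbb C_-$) the function $(\mathcal M(\lambda)+\mu)^{-1}$ has values in $\mathbf B(\mathfrak M)$ and is holomorphic on $\mathbb C_+$ (resp. $\mathbb C_-$). A family $\mathcal M(\lambda)$, $\lambda\in\mathbb C\setminus[0,\infty)$, is a *Stieltjes family*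 (resp. *inverse Stieltjes family*) if it is a Nevanlinna family, $(f',f)\ge0$ (resp. $\le0$) for all $\{f,f'\}\in\mathcal M(x)$ and $x<0$, and for some $\mu\in\mathbb C_+$ (resp. $\mathbb C_-$) the function $(\mathcal M(\lambda)+\mu)^{-1}$ on $\mathbb C_+$ (resp. $\mathbb C_-$) has an analytic continuation to $(-\infty,0)$ whose value at each $x<0$ is $(\mathcal M(x)+\mu)^{-1}\in\mathbf B(\mathfrak M)$. The class $\mathcal{RS}(\mathfrak M)$ consists of the $\mathbf B(\mathfrak M)$-valued Nevanlinna functions $\Omega$ that are holomorphic on $D=\mathbb C\setminus((-\infty,-1]\cup[1,\infty))$ and satisfy $-I\le\Omega(x)\le I$ for $x\in(-1,1)$. For a function $\Omega:D\to\mathbf B(\mathfrak M)$ and $\lambda\in\mathbb C\setminus[0,\infty)$ put $$\mathcal Q_\Omega(\lambda)=-I+2\Big(I-\Omega\big(\tfrac{1+\lambda}{1-\lambda}\big)\Big)^{-1},\qquad \mathcal R_\Omega(\lambda)=I-2\Big(I+\Omega\big(\tfrac{1+\lambda}{1-\lambda}\big)\Big)^{-1}.$$ Then: 1. With $z=\frac{1+\lambda}{1-\lambda}$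 one has $\mathcal Q_\Omega(\lambda)=\{\{(I-\Omega(z))h,(I+\Omega(z))h\}:h\in\mathfrak M\}$, $\mathcal R_\Omega(\lambda)=\{\{(I+\Omega(z))h,(\Omega(z)-I)h\}:h\in\mathfrak M\}$ and $\mathcal R_\Omega(\lambda)=-\mathcal Q_\Omega(\lambda)^{-1}$. 2. $\Omega\in\mathcal{RS}(\mathfrak M)$ if and only if $\mathcal Q_\Omega$ is a Stieltjes family, and if and only if $\mathcal R_\Omega$ is an inverse Stieltjes family. 3. For every Stieltjes family $\mathcal Q$ (resp. inverse Stieltjes family $\mathcal R$) in $\mathfrak M$ there is $\Omega\in\mathcal{RS}(\mathfrak M)$ with $\mathcal Q=\mathcal Q_\Omega$ (resp. $\mathcal R=\mathcal R_\Omega$) on $\mathbb C\setminus[0,\infty)$. 4. A family $\mathcal Q$ of linear relations in $\mathfrak M$ is a Stieltjes family if and only if $-\mathcal Q^{-1}$ is an inverse Stieltjes family. -/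

import Mathlib

noncomputable section

/-- A linear relation in `M`: a linear subspace of `M × M`, whose elements are the pairs
`{f, f'}`. -/
abbrev LinRel (M : Type*) [NormedAddCommGroup M] [InnerProductSpace ℂ M] : Type _ :=
  Submodule ℂ (M × M)

namespace LinRel

variable {M : Type*} [NormedAddCommGroup M] [InnerProductSpace ℂ M]

/-- A bounded operator regarded as a linear relation, namely its graph. -/
def ofOp (T : M →L[ℂ] M) : LinRel M := LinearMap.graph (T : M →ₗ[ℂ] M)

/-- The inverse relation `{ {f', f} : {f, f'} ∈ A }`. -/
def inv (A : LinRel M) : LinRel M where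
  carrier := {p | (p.2, p.1) ∈ A}
  add_mem' := fun ha hb => A.add_mem ha hb
  zero_mem' := A.zero_mem
  smul_mem' := fun c _ ha => A.smul_mem c ha

/-- The scalar multiple `{ {f, c f'} : {f, f'} ∈ A }`. -/
def smul (c : ℂ) (A : LinRel M) : LinRel M where
  carrier := {p | ∃ g, (p.1, g) ∈ A ∧ p.2 = c • g}
  add_mem' := by
    rintro _ _ ⟨g, hg, h1⟩ ⟨k, hk, h2⟩
    exact ⟨g + k, A.add_mem hg hk, by simp [h1, h2]⟩
  zero_mem' := ⟨0, A.zero_mem, by simp⟩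
  smul_mem' := by
    rintro a _ ⟨g, hg, h1⟩
    exact ⟨a • g, A.smul_mem a hg, by simp [h1, smul_comm a c g]⟩

/-- The operator-like sum `{ {f, g + k} : {f, g} ∈ A, {f, k} ∈ B }`. -/
def add (A B : LinRel M) : LinRel M where
  carrier := {p | ∃ g k, (p.1, g) ∈ A ∧ (p.1, k) ∈ B ∧ p.2 = g + k}
  add_mem' := by
    rintro _ _ ⟨g, k, hg, hk, h1⟩ ⟨g', k', hg', hk', h2⟩
    exact ⟨g + g', k + k', A.add_mem hg hg', B.add_mem hk hk', by
      simp [h1, h2, add_add_add_comm]⟩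
  zero_mem' := ⟨0, 0, A.zero_mem, B.zero_mem, by simp⟩
  smul_mem' := by
    rintro a _ ⟨g, k, hg, hk, h1⟩
    exact ⟨a • g, a • k, A.smul_mem a hg, B.smul_mem a hk, by simp [h1]⟩

/-- `-A`. -/
def neg (A : LinRel M) : LinRel M := smul (-1) A

/-- `(A + μ)⁻¹`, a linear relation in general. -/
def shiftInv (A : LinRel M) (μ : ℂ) : LinRel M := inv (add A (ofOp (μ • 1)))

/-- `Im (f', f) ≥ 0` for all `{f, f'} ∈ A`; Mathlib's inner product is conjugate-linear in its
first argument, so that `(f', f)` is `inner ℂ f f'`. -/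
def IsDissipative (A : LinRel M) : Prop := ∀ p ∈ A, 0 ≤ (inner ℂ p.1 p.2).im

/-- `Im (f', f) ≤ 0` for all `{f, f'} ∈ A`. -/
def IsAccumulative (A : LinRel M) : Prop := ∀ p ∈ A, (inner ℂ p.1 p.2).im ≤ 0

/-- `(f', f) ≥ 0` for all `{f, f'} ∈ A`. -/
def IsNonneg (A : LinRel M) : Prop :=
  ∀ p ∈ A, (inner ℂ p.1 p.2).im = 0 ∧ 0 ≤ (inner ℂ p.1 p.2).re

/-- `(f', f) ≤ 0` for all `{f, f'} ∈ A`. -/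
def IsNonpos (A : LinRel M) : Prop :=
  ∀ p ∈ A, (inner ℂ p.1 p.2).im = 0 ∧ (inner ℂ p.1 p.2).re ≤ 0

end LinRel

section Families

variable {M : Type*} [NormedAddCommGroup M] [InnerProductSpace ℂ M]

/-- The open upper half-plane. -/
def upperHalf : Set ℂ := {z | 0 < z.im}

/-- The open lower half-plane. -/
def lowerHalf : Set ℂ := {z | z.im < 0}

/-- The open negative half-axis `(-∞, 0)`. -/
def negAxis : Set ℂ := {z | z.im = 0 ∧ z.re < 0}

/-- `ℂ \ [0, ∞)`. -/
def cutPlane : Set ℂ := {z | ¬(z.im = 0 ∧ 0 ≤ z.re)}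

/-- `ℂ \ ((-∞, -1] ∪ [1, ∞))`. -/
def doublyCutPlane : Set ℂ := {z | ¬(z.im = 0 ∧ (z.re ≤ -1 ∨ 1 ≤ z.re))}

/-- For every `l ∈ S` the relation `(𝓜(l) + μ)⁻¹` is (the graph of) an everywhere defined bounded
operator `F l`, and `F` is analytic at every point of `S`. If `S` is open, this says that
`(𝓜(l) + μ)⁻¹` is a holomorphic operator function on `S`; if `S` is a half-plane together with a
piece of its boundary, it says moreover that this function has an analytic continuation across
that piece, whose values there are `(𝓜(l) + μ)⁻¹`. -/
def ResolventAnalyticOn (𝓜 : ℂ → LinRel M) (μ : ℂ) (S : Set ℂ) : Prop :=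
  ∃ F : ℂ → M →L[ℂ] M, AnalyticOnNhd ℂ F S ∧
    ∀ l ∈ S, LinRel.shiftInv (𝓜 l) μ = LinRel.ofOp (F l)

/-- Nevanlinna families. Only the values of `𝓜` on `ℂ \ ℝ` matter. -/
structure IsNevanlinnaFamily [CompleteSpace M] (𝓜 : ℂ → LinRel M) : Prop where
  dissipative : ∀ l ∈ upperHalf, Maximal LinRel.IsDissipative (𝓜 l)
  accumulative : ∀ l ∈ lowerHalf, Maximal LinRel.IsAccumulative (𝓜 l)
  adjoint_eq : ∀ l : ℂ, l.im ≠ 0 → (𝓜 l).adjoint = 𝓜 (starRingEnd ℂ l)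
  holomorphic_upper : ∃ μ ∈ upperHalf, ResolventAnalyticOn 𝓜 μ upperHalf
  holomorphic_lower : ∃ μ ∈ lowerHalf, ResolventAnalyticOn 𝓜 μ lowerHalf

/-- Stieltjes families. Only the values of `𝓜` on `ℂ \ [0, ∞)` matter. -/
structure IsStieltjesFamily [CompleteSpace M] (𝓜 : ℂ → LinRel M) : Prop where
  nevanlinna : IsNevanlinnaFamily 𝓜
  nonneg : ∀ x ∈ negAxis, LinRel.IsNonneg (𝓜 x)
  continuation_upper : ∃ μ ∈ upperHalf, ResolventAnalyticOn 𝓜 μ (upperHalf ∪ negAxis)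
  continuation_lower : ∃ μ ∈ lowerHalf, ResolventAnalyticOn 𝓜 μ (lowerHalf ∪ negAxis)

/-- Inverse Stieltjes families. Only the values of `𝓜` on `ℂ \ [0, ∞)` matter. -/
structure IsInverseStieltjesFamily [CompleteSpace M] (𝓜 : ℂ → LinRel M) : Prop where
  nevanlinna : IsNevanlinnaFamily 𝓜
  nonpos : ∀ x ∈ negAxis, LinRel.IsNonpos (𝓜 x)
  continuation_upper : ∃ μ ∈ upperHalf, ResolventAnalyticOn 𝓜 μ (upperHalf ∪ negAxis)
  continuation_lower : ∃ μ ∈ lowerHalf, ResolventAnalyticOn 𝓜 μ (lowerHalf ∪ negAxis)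

/-- The combined Nevanlinna-Schur class: bounded-operator-valued Nevanlinna functions that are
holomorphic on `ℂ \ ((-∞, -1] ∪ [1, ∞))` and satisfy `-I ≤ Ω(x) ≤ I` on `(-1, 1)`. Only the values
of `Ω` on `ℂ \ ((-∞, -1] ∪ [1, ∞))` matter. -/
structure IsNevanlinnaSchur [CompleteSpace M] (Ω : ℂ → M →L[ℂ] M) : Prop where
  nevanlinna : IsNevanlinnaFamily fun z => LinRel.ofOp (Ω z)
  holomorphic : DifferentiableOn ℂ Ω doublyCutPlane
  bounds : ∀ x : ℝ, -1 < x → x < 1 → -1 ≤ Ω (x : ℂ) ∧ Ω (x : ℂ) ≤ 1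

/-- `𝒬(l) = -I + 2 (I - Ω((1 + l)/(1 - l)))⁻¹`, in the sense of linear relations. -/
def stieltjesTransform (Ω : ℂ → M →L[ℂ] M) (l : ℂ) : LinRel M :=
  LinRel.add (LinRel.ofOp (-1))
    (LinRel.smul 2 (LinRel.inv (LinRel.ofOp (1 - Ω ((1 + l) / (1 - l))))))

/-- `ℛ(l) = I - 2 (I + Ω((1 + l)/(1 - l)))⁻¹`, in the sense of linear relations. -/
def inverseStieltjesTransform (Ω : ℂ → M →L[ℂ] M) (l : ℂ) : LinRel M :=
  LinRel.add (LinRel.ofOp 1)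
    (LinRel.neg (LinRel.smul 2 (LinRel.inv (LinRel.ofOp (1 + Ω ((1 + l) / (1 - l)))))))

end Families

end

noncomputable section

open scoped ComplexConjugate Topology

open LinRel Filter

/-! With `T = Ω(z)` and `z = (1 + l)/(1 - l)`, the Stieltjes transform is the relation of pairs `((1
- T)h, (1 + T)h)`, a rotation `cayley` of the graph of `T`. This rotation is an order automorphism
of the relations that commutes with adjoints and doubles the imaginary part of the form. Hence it
preserves maximal dissipativity and the symmetry under conjugation. The real part of the form
becomes `‖h‖² - ‖T h‖²`, so nonnegativity means that `T` is a symmetric contraction, that is, `-1 ≤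
T ≤ 1`. As the Möbius map preserves the half-planes and carries the negative axis onto `(-1, 1)`,
the two classes correspond. Analyticity passes between `Ω` and the resolvents by explicit fractional
linear formulas. The inverse Stieltjes statements follow by the involution `A ↦ -A⁻¹`.

The hard point is that every Stieltjes family arises in this way, that is, `-1` is a regular point
of each relation `Q l`. For a resolvent `F` at `-μ`, the operator `1 + (1 - μ) F` sends `f' + μ f`
to `f + f'`, so it must be shown invertible (`IsStieltjesFamily.isUnit_one_add_smul`). After
multiplication by a constant depending only on `μ` it becomes `N l = 1 - contraction`, hence has
nonnegative real part, because the relation is dissipative. On the negative axis nonnegativity gives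
a uniform positive lower bound for this real part (`norm_le_of_isNonneg`). The bound survives by
continuity at a nearby point of the upper half-plane and spreads to every other point there by
Harnack's inequality, applied to `⟨g, N l g⟩` with a constant independent of `g`. The lower
half-plane follows by taking adjoints. -/

/-- Maximality is transported by an order isomorphism that preserves the predicate. -/
theorem OrderIso.maximal_apply_iff {α : Type*} [PartialOrder α] (e : α ≃o α) {P : α → Prop}
    (hP : ∀ a, P (e a) ↔ P a) (a : α) : Maximal P (e a) ↔ Maximal P a := by
  constructor
  · rintro ⟨h1, h2⟩
    refine ⟨(hP a).1 h1, fun b hb hab => ?_⟩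
    exact e.le_iff_le.1 (h2 ((hP b).2 hb) (e.le_iff_le.2 hab))
  · rintro ⟨h1, h2⟩
    refine ⟨(hP a).2 h1, fun b hb hab => ?_⟩
    obtain ⟨c, rfl⟩ := e.surjective b
    exact e.le_iff_le.2 (h2 ((hP c).1 hb) (e.le_iff_le.1 hab))

/-! ### Linear relations: the involution `-A⁻¹`, the Cayley-type rotation and resolvents. -/

namespace LinRel

variable {M : Type*} [NormedAddCommGroup M] [InnerProductSpace ℂ M]

theorem mem_ofOp {T : M →L[ℂ] M} {p : M × M} : p ∈ ofOp T ↔ p.2 = T p.1 := by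
  simp [ofOp, LinearMap.mem_graph_iff]

theorem ofOp_injective : Function.Injective (ofOp : (M →L[ℂ] M) → LinRel M) := by
  intro S T h
  ext x
  have hx : (x, S x) ∈ ofOp T := h ▸ mem_ofOp.2 rfl
  exact mem_ofOp.1 hx

theorem mem_shiftInv {A : LinRel M} {μ : ℂ} {p : M × M} :
    p ∈ shiftInv A μ ↔ (p.2, p.1 - μ • p.2) ∈ A := by
  constructor
  · rintro ⟨g, k, hg, hk, h⟩
    have hk : k = μ • p.2 := by simpa using mem_ofOp.1 hk
    have h : p.1 = g + k := h
    rw [h, hk, add_sub_cancel_right]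
    exact hg
  · intro h
    exact ⟨_, μ • p.2, h, mem_ofOp.2 (by simp), by simp⟩

/-- The working form of a bounded resolvent: a single equation in `f` and `f'` that determines the
whole relation. -/
theorem shiftInv_eq_ofOp_iff {A : LinRel M} {μ : ℂ} {F : M →L[ℂ] M} :
    shiftInv A μ = ofOp F ↔ ∀ f f', (f, f') ∈ A ↔ F (f' + μ • f) = f := by
  constructor
  · intro h f f'
    have := congrArg (fun B : LinRel M => (f' + μ • f, f) ∈ B) h
    simp only [mem_shiftInv, mem_ofOp, add_sub_cancel_right, eq_iff_iff] at this
    rw [this, eq_comm]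
  · intro h
    ext ⟨g, f⟩
    rw [mem_shiftInv, mem_ofOp, h]
    simp [eq_comm]

/-- Membership in the relation `-A⁻¹`. -/
theorem mem_neg_inv {A : LinRel M} {p : M × M} : p ∈ neg (inv A) ↔ (p.2, -p.1) ∈ A := by
  constructor
  · rintro ⟨g, hg, h⟩
    have hg : (g, p.1) ∈ A := hg
    have := A.neg_mem hg
    rw [h]
    simpa using this
  · intro h
    refine ⟨-p.2, ?_, by simp⟩
    have := A.neg_mem h
    rwa [Prod.neg_mk, neg_neg] at this

theorem neg_inv_neg_inv (A : LinRel M) : neg (inv (neg (inv A))) = A := by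
  ext ⟨f, f'⟩
  rw [mem_neg_inv, mem_neg_inv, ← neg_mem_iff]
  simp

/-- The involution `A ↦ -A⁻¹` of the lattice of linear relations. -/
def negInv : LinRel M ≃o LinRel M where
  toFun A := neg (inv A)
  invFun A := neg (inv A)
  left_inv := neg_inv_neg_inv
  right_inv := neg_inv_neg_inv
  map_rel_iff' {A B} := by
    have key : ∀ {A B : LinRel M}, A ≤ B → neg (inv A) ≤ neg (inv B) := fun h p hp =>
      mem_neg_inv.2 (h (mem_neg_inv.1 hp))
    refine ⟨fun h => ?_, key⟩
    have : neg (inv (neg (inv A))) ≤ neg (inv (neg (inv B))) := key h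
    rwa [neg_inv_neg_inv, neg_inv_neg_inv] at this

theorem mem_negInv {A : LinRel M} {p : M × M} : p ∈ negInv A ↔ (p.2, -p.1) ∈ A := mem_neg_inv

theorem negInv_negInv (A : LinRel M) : negInv (negInv A) = A := neg_inv_neg_inv A

/-- The Cayley-type transform `{ {h - k, h + k} : {h, k} ∈ A }` of a linear relation, described
through the membership of `{f + f', f' - f}` in `A`. -/
def cayley : LinRel M ≃o LinRel M where
  toFun A :=
    { carrier := {p | (p.1 + p.2, p.2 - p.1) ∈ A}
      add_mem' := fun {p q} hp hq => by
        have := A.add_mem hp hq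
        simpa only [Set.mem_ofPred_eq, Prod.fst_add, Prod.snd_add, Prod.mk_add_mk,
          add_add_add_comm, add_sub_add_comm] using this
      zero_mem' := by simp [← Prod.zero_eq_mk]
      smul_mem' := fun c p hp => by
        have := A.smul_mem c hp
        simpa only [Set.mem_ofPred_eq, Prod.smul_fst, Prod.smul_snd, Prod.smul_mk, smul_add,
          smul_sub] using this }
  invFun A :=
    { carrier := {p | (p.1 - p.2, p.1 + p.2) ∈ A}
      add_mem' := fun {p q} hp hq => by
        have := A.add_mem hp hq
        simpa only [Set.mem_ofPred_eq, Prod.fst_add, Prod.snd_add, Prod.mk_add_mk,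
          add_add_add_comm, add_sub_add_comm] using this
      zero_mem' := by simp [← Prod.zero_eq_mk]
      smul_mem' := fun c p hp => by
        have := A.smul_mem c hp
        simpa only [Set.mem_ofPred_eq, Prod.smul_fst, Prod.smul_snd, Prod.smul_mk, smul_add,
          smul_sub] using this }
  left_inv A := by
    ext ⟨a, b⟩
    change (a - b + (a + b), a + b - (a - b)) ∈ A ↔ _
    -- The two formulas omit the normalising factor 1/2; their composition multiplies a pair by 2,
    -- which does not affect membership in a subspace.
    rw [← A.smul_mem_iff (two_ne_zero (α := ℂ)) (x := (a, b))]
    rw [two_smul, Prod.mk_add_mk, show a - b + (a + b) = a + a by abel, show a + b - (a - b) = b + b by abel]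
  right_inv A := by
    ext ⟨a, b⟩
    change (a + b - (b - a), a + b + (b - a)) ∈ A ↔ _
    rw [← A.smul_mem_iff (two_ne_zero (α := ℂ)) (x := (a, b))]
    rw [two_smul, Prod.mk_add_mk, show a + b - (b - a) = a + a by abel, show a + b + (b - a) = b + b by abel]
  map_rel_iff' {A B} := by
    refine ⟨fun h p hp => ?_, fun h p hp => h hp⟩
    have h2 : ((2 : ℂ)⁻¹ • (p.1 - p.2), (2 : ℂ)⁻¹ • (p.1 + p.2)) ∈
        {p : M × M | (p.1 + p.2, p.2 - p.1) ∈ A} := by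
      change _ ∈ A
      convert hp using 1
      ext <;> simp only <;> module
    have h3 : ((2 : ℂ)⁻¹ • (p.1 - p.2) + (2 : ℂ)⁻¹ • (p.1 + p.2),
        (2 : ℂ)⁻¹ • (p.1 + p.2) - (2 : ℂ)⁻¹ • (p.1 - p.2)) ∈ B := h h2
    convert h3 using 1
    ext <;> simp only <;> module

theorem mem_cayley {A : LinRel M} {p : M × M} : p ∈ cayley A ↔ (p.1 + p.2, p.2 - p.1) ∈ A :=
  Iff.rfl

theorem mem_cayley_symm {A : LinRel M} {p : M × M} :
    p ∈ cayley.symm A ↔ (p.1 - p.2, p.1 + p.2) ∈ A :=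
  Iff.rfl

theorem mem_cayley_ofOp {T : M →L[ℂ] M} {p : M × M} :
    p ∈ cayley (ofOp T) ↔ p.2 - p.1 = T (p.1 + p.2) := by
  rw [mem_cayley, mem_ofOp]

theorem mem_cayley_ofOp_iff_exists {T : M →L[ℂ] M} {p : M × M} :
    p ∈ cayley (ofOp T) ↔ ∃ h, p = ((1 - T) h, (1 + T) h) := by
  rw [mem_cayley_ofOp]
  constructor
  · intro h
    refine ⟨(2 : ℂ)⁻¹ • (p.1 + p.2), ?_⟩
    ext <;> simp only [sub_apply, add_apply, one_apply_eq_self,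
      map_smul, ← h] <;> module
  · rintro ⟨h, rfl⟩
    have e : (1 - T) h + (1 + T) h = (2 : ℂ) • h := by
      simp only [sub_apply, add_apply,
        one_apply_eq_self]
      module
    simp only [e, map_smul]
    simp only [sub_apply, add_apply,
      one_apply_eq_self]
    module

/-- The identity behind all sign conditions: the imaginary part of the form is doubled, while its
real part becomes a difference of squared norms. -/
theorem cayley_inner (a b : M) :
    inner ℂ (a - b) (a + b) = ((‖a‖ ^ 2 - ‖b‖ ^ 2 : ℝ) : ℂ) + (inner ℂ a b - conj (inner ℂ a b)) := by
  rw [inner_sub_left, inner_add_right, inner_add_right, inner_self_eq_norm_sq_to_K,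
    inner_self_eq_norm_sq_to_K, inner_conj_symm]
  push_cast
  simp only [Complex.coe_algebraMap]
  ring

theorem cayley_inner_im (a b : M) : (inner ℂ (a - b) (a + b)).im = 2 * (inner ℂ a b).im := by
  rw [cayley_inner]
  simp only [Complex.add_im, Complex.ofReal_im, Complex.sub_im, Complex.conj_im]
  ring

theorem cayley_inner_re (a b : M) : (inner ℂ (a - b) (a + b)).re = ‖a‖ ^ 2 - ‖b‖ ^ 2 := by
  rw [cayley_inner]
  simp only [Complex.add_re, Complex.ofReal_re, Complex.sub_re, Complex.conj_re]
  ring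

theorem forall_mem_cayley_symm {A : LinRel M} {P : M × M → Prop} :
    (∀ p ∈ A, P p) ↔ ∀ p ∈ cayley.symm A, P (p.1 - p.2, p.1 + p.2) := by
  constructor
  · exact fun h p hp => h _ hp
  · intro h p hp
    have := h ((2 : ℂ)⁻¹ • (p.1 + p.2), (2 : ℂ)⁻¹ • (p.2 - p.1)) (by
      rw [mem_cayley_symm]
      convert hp using 1
      ext <;> simp only <;> module)
    convert this using 1
    ext <;> simp only <;> module

theorem isDissipative_cayley (A : LinRel M) : IsDissipative (cayley A) ↔ IsDissipative A := by
  rw [IsDissipative, forall_mem_cayley_symm, OrderIso.symm_apply_apply]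
  simp only [cayley_inner_im]
  simp [IsDissipative]

theorem isAccumulative_cayley (A : LinRel M) : IsAccumulative (cayley A) ↔ IsAccumulative A := by
  rw [IsAccumulative, forall_mem_cayley_symm, OrderIso.symm_apply_apply]
  simp only [cayley_inner_im]
  refine forall₂_congr fun p _ => ?_
  constructor <;> intro h <;> linarith

theorem isNonneg_cayley_ofOp (T : M →L[ℂ] M) :
    IsNonneg (cayley (ofOp T)) ↔ ∀ h, (inner ℂ h (T h)).im = 0 ∧ ‖T h‖ ≤ ‖h‖ := by
  rw [IsNonneg, forall_mem_cayley_symm, OrderIso.symm_apply_apply]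
  simp only [cayley_inner_im, cayley_inner_re]
  constructor
  · intro H h
    obtain ⟨h1, h2⟩ := H (h, T h) (mem_ofOp.2 rfl)
    refine ⟨by simpa using h1, ?_⟩
    exact abs_le_of_sq_le_sq' (by linarith : ‖T h‖ ^ 2 ≤ ‖h‖ ^ 2) (norm_nonneg _) |>.2
  · rintro H ⟨h, k⟩ hk
    obtain rfl : k = T h := mem_ofOp.1 hk
    obtain ⟨h1, h2⟩ := H h
    refine ⟨by simp [h1], ?_⟩
    have := pow_le_pow_left₀ (norm_nonneg _) h2 2
    simpa using this

/-- The rotation preserves, up to sign, the boundary form `⟨f', g⟩ - ⟨f, g'⟩` that defines the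
adjoint; this is `key`. -/
theorem adjoint_cayley (A : LinRel M) : (cayley A).adjoint = cayley A.adjoint := by
  have key : ∀ a b c d : M, inner ℂ (a + b) c - inner ℂ (a - b) d =
      inner ℂ b (c + d) - inner ℂ a (d - c) := by
    intro a b c d
    simp only [inner_add_left, inner_sub_left, inner_add_right, inner_sub_right]
    ring
  ext x
  rw [mem_cayley, Submodule.mem_adjoint_iff, Submodule.mem_adjoint_iff]
  have h := forall_mem_cayley_symm (A := cayley A)
    (P := fun p => inner ℂ p.2 x.1 - inner ℂ p.1 x.2 = 0)
  rw [OrderIso.symm_apply_apply] at h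
  simpa only [Prod.forall, key] using h

theorem forall_mem_negInv {A : LinRel M} {P : M × M → Prop} :
    (∀ p ∈ negInv A, P p) ↔ ∀ p ∈ A, P (-p.2, p.1) := by
  constructor
  · intro h p hp
    exact h _ (mem_negInv.2 (by simpa using hp))
  · intro h p hp
    simpa using h _ (mem_negInv.1 hp)

theorem inner_neg_swap (a b : M) : inner ℂ (-b) a = -conj (inner ℂ a b) := by
  rw [inner_neg_left, inner_conj_symm]

theorem isDissipative_negInv (A : LinRel M) : IsDissipative (negInv A) ↔ IsDissipative A := by
  rw [IsDissipative, forall_mem_negInv]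
  simp only [inner_neg_swap]
  simp [-inner_conj_symm, IsDissipative]

theorem isAccumulative_negInv (A : LinRel M) : IsAccumulative (negInv A) ↔ IsAccumulative A := by
  rw [IsAccumulative, forall_mem_negInv]
  simp only [inner_neg_swap]
  simp [-inner_conj_symm, IsAccumulative]

theorem isNonpos_negInv (A : LinRel M) : IsNonpos (negInv A) ↔ IsNonneg A := by
  rw [IsNonpos, forall_mem_negInv]
  simp only [inner_neg_swap]
  simp [-inner_conj_symm, IsNonneg]

theorem isNonneg_negInv (A : LinRel M) : IsNonneg (negInv A) ↔ IsNonpos A := by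
  rw [← isNonpos_negInv, negInv_negInv]

theorem adjoint_negInv (A : LinRel M) : (negInv A).adjoint = negInv A.adjoint := by
  ext x
  rw [mem_negInv, Submodule.mem_adjoint_iff, Submodule.mem_adjoint_iff]
  have h := forall_mem_negInv (A := A) (P := fun p => inner ℂ p.2 x.1 - inner ℂ p.1 x.2 = 0)
  have key : ∀ a b : M, inner ℂ a x.1 - inner ℂ (-b) x.2 = inner ℂ b x.2 - inner ℂ a (-x.1) := by
    intro a b
    simp only [inner_neg_left, inner_neg_right]
    ring
  simpa only [Prod.forall, key] using h

theorem adjoint_ofOp [CompleteSpace M] (T : M →L[ℂ] M) :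
    (ofOp T).adjoint = ofOp (ContinuousLinearMap.adjoint T) := by
  ext x
  rw [Submodule.mem_adjoint_iff, mem_ofOp]
  constructor
  · intro h
    refine ext_inner_left ℂ fun v => ?_
    have := h v (T v) (mem_ofOp.2 rfl)
    rw [ContinuousLinearMap.adjoint_inner_right]
    exact (sub_eq_zero.1 this).symm
  · intro h a b hab
    rw [h, ContinuousLinearMap.adjoint_inner_right]
    simp [show b = T a from mem_ofOp.1 hab]

/-- For `(f, f')` in `A` put `g = f' + μ f`. Then `(f', -f)` lies in `-A⁻¹`, and `-f - μ⁻¹ f' = -μ⁻¹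
g` while `f' = (1 - μ F) g`. -/
theorem shiftInv_negInv {A : LinRel M} {μ : ℂ} {F : M →L[ℂ] M} (hμ : μ ≠ 0)
    (h : shiftInv A μ = ofOp F) :
    shiftInv (negInv A) (-μ⁻¹) = ofOp (-μ • (1 - μ • F)) := by
  rw [shiftInv_eq_ofOp_iff] at h ⊢
  intro p q
  rw [mem_negInv, h]
  have e : q + -μ⁻¹ • p = μ⁻¹ • (-p + μ • q) := by
    rw [smul_add, smul_smul, inv_mul_cancel₀ hμ, one_smul]
    module
  rw [e]
  simp only [smul_apply, sub_apply, map_smul,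
    one_apply_eq_self]
  generalize F (-p + μ • q) = y
  have e2 : μ⁻¹ • -μ • (-p + μ • q - μ • y) = p + μ • (y - q) := by
    rw [smul_smul, mul_neg, inv_mul_cancel₀ hμ]
    module
  rw [e2, add_eq_left, smul_eq_zero, or_iff_right hμ, sub_eq_zero]

theorem shiftInv_ofOp {T V : M →L[ℂ] M} {μ : ℂ} (h1 : (T + μ • 1) * V = 1)
    (h2 : V * (T + μ • 1) = 1) : shiftInv (ofOp T) μ = ofOp V := by
  rw [shiftInv_eq_ofOp_iff]
  intro f f'
  rw [mem_ofOp]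
  constructor
  · intro h
    obtain rfl : f' = T f := h
    simpa using congrArg (fun B : M →L[ℂ] M => B f) h2
  · intro h
    have := congrArg (fun B : M →L[ℂ] M => B (f' + μ • f)) h1
    simp only [mul_apply_eq_comp, h, add_apply,
      smul_apply, one_apply_eq_self] at this
    exact (add_right_cancel this).symm

/-- For `f = (1 - T) h` and `f' = (1 + T) h` one has `f' + μ f = ((1 + μ) + (1 - μ) T) h`, and `V`
recovers `h` from it. -/
theorem shiftInv_cayley_ofOp {T V : M →L[ℂ] M} {μ : ℂ}
    (h1 : ((1 + μ) • 1 + (1 - μ) • T) * V = 1) (h2 : V * ((1 + μ) • 1 + (1 - μ) • T) = 1) :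
    shiftInv (cayley (ofOp T)) μ = ofOp ((1 - T) * V) := by
  have e : ∀ h, (1 + T) h + μ • (1 - T) h = ((1 + μ) • 1 + (1 - μ) • T) h := by
    intro h
    simp only [add_apply, sub_apply,
      smul_apply, one_apply_eq_self]
    module
  rw [shiftInv_eq_ofOp_iff]
  intro f f'
  rw [mem_cayley_ofOp_iff_exists]
  constructor
  · rintro ⟨h, hh⟩
    obtain ⟨rfl, rfl⟩ := Prod.ext_iff.1 hh
    have := congrArg (fun B : M →L[ℂ] M => B h) h2
    simp only [mul_apply_eq_comp] at this
    rw [e, mul_apply_eq_comp, this]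
    rfl
  · intro h
    have h3 := congrArg (fun B : M →L[ℂ] M => B (f' + μ • f)) h1
    rw [mul_apply_eq_comp] at h
    simp only [mul_apply_eq_comp, ← e, h] at h3
    refine ⟨V (f' + μ • f), Prod.ext h.symm ?_⟩
    exact (add_right_cancel h3).symm

/-- A relation with bounded resolvent `F` at `-μ` is the Cayley-type transform of a bounded operator
as soon as `1 + (1 - μ) F` is invertible. -/
theorem eq_cayley_ofOp {A : LinRel M} {μ : ℂ} {F : M →L[ℂ] M} (hF : shiftInv A μ = ofOp F)
    (hW : IsUnit (1 + (1 - μ) • F)) :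
    A = cayley (ofOp (Ring.inverse (1 + (1 - μ) • F) * (1 - (1 + μ) • F))) := by
  rw [shiftInv_eq_ofOp_iff] at hF
  have h1 := Ring.inverse_mul_cancel _ hW
  have h2 := Ring.mul_inverse_cancel _ hW
  set W := 1 + (1 - μ) • F with hWdef
  set V := Ring.inverse W
  ext ⟨f, f'⟩
  rw [hF, mem_cayley_ofOp]
  simp only [mul_apply_eq_comp]
  have a1 : ∀ x, V (W x) = x := fun x => congrArg (fun B : M →L[ℂ] M => B x) h1
  have a2 : ∀ x, W (V x) = x := fun x => congrArg (fun B : M →L[ℂ] M => B x) h2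
  -- The equation for the graph of the transformed operator, multiplied by `W`, is twice the
  -- resolvent equation.
  have e : (1 - (1 + μ) • F) (f + f') - W (f' - f) = (2 : ℂ) • (f - F (f' + μ • f)) := by
    simp only [hWdef, add_apply, sub_apply,
      smul_apply, one_apply_eq_self, map_add, map_sub, map_smul]
    module
  trans (1 - (1 + μ) • F) (f + f') = W (f' - f)
  · rw [← sub_eq_zero, ← sub_eq_zero (b := W _), e, smul_eq_zero, or_iff_right two_ne_zero,
      ← neg_eq_zero, neg_sub]
  · constructor
    · intro h
      rw [h, a1]
    · intro h
      rw [h, a2]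

/-- With `g = f' + μ f = U h`, the operator sends `g` to `f + f' = 2 h`, so its inverse is `U / 2`.
-/
theorem isUnit_of_cayley_ofOp {T F : M →L[ℂ] M} {μ : ℂ}
    (hF : shiftInv (cayley (ofOp T)) μ = ofOp F) : IsUnit (1 + (1 - μ) • F) := by
  rw [shiftInv_eq_ofOp_iff] at hF
  set U : M →L[ℂ] M := (1 + μ) • 1 + (1 - μ) • T with hU
  refine ⟨⟨1 + (1 - μ) • F, (2 : ℂ)⁻¹ • U, ?_, ?_⟩, rfl⟩
  · ext h
    have h1 : F (U h) = (1 - T) h := by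
      convert (hF _ _).1 (mem_cayley_ofOp_iff_exists.2 ⟨h, rfl⟩) using 2
      simp only [hU, add_apply, sub_apply,
        smul_apply, one_apply_eq_self]
      module
    simp only [mul_apply_eq_comp, smul_apply, map_smul,
      add_apply, one_apply_eq_self, h1]
    simp only [hU, add_apply, sub_apply,
      smul_apply, one_apply_eq_self]
    module
  · ext g
    have h1 := (hF (F g) (g - μ • F g)).2 (by simp)
    rw [mem_cayley_ofOp] at h1
    have e : (1 + (1 - μ) • F) g = F g + (g - μ • F g) := by
      simp only [add_apply, smul_apply,
        one_apply_eq_self]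
      module
    rw [mul_apply_eq_comp, e]
    simp only [hU, smul_apply, add_apply,
      one_apply_eq_self] at h1 ⊢
    rw [← h1]
    module

/-- This formula is analytic in `F`, so analyticity of the resolvent passes to the operator
function. -/
theorem eq_of_shiftInv_cayley_ofOp {T F : M →L[ℂ] M} {μ : ℂ}
    (hF : shiftInv (cayley (ofOp T)) μ = ofOp F) :
    T = Ring.inverse (1 + (1 - μ) • F) * (1 - (1 + μ) • F) :=
  ofOp_injective (cayley.injective (eq_cayley_ofOp hF (isUnit_of_cayley_ofOp hF)))

end LinRel

/-! ### The Stieltjes and inverse Stieltjes transforms as rotated graphs. -/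

section Transforms

variable {M : Type*} [NormedAddCommGroup M] [InnerProductSpace ℂ M]

theorem stieltjesTransform_eq_cayley (Ω : ℂ → M →L[ℂ] M) (l : ℂ) :
    stieltjesTransform Ω l = cayley (ofOp (Ω ((1 + l) / (1 - l)))) := by
  ext ⟨f, f'⟩
  rw [mem_cayley_ofOp]
  unfold stieltjesTransform
  generalize Ω ((1 + l) / (1 - l)) = T
  constructor
  · rintro ⟨g, k, hg, ⟨h, hh, hk⟩, hf⟩
    have hg : g = -f := by simpa using mem_ofOp.1 hg
    have hh : f = h - T h := by simpa using mem_ofOp.1 (show (h, f) ∈ ofOp (1 - T) from hh)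
    have hk : k = (2 : ℂ) • h := hk
    have hf : f' = g + k := hf
    have e : f + f' = (2 : ℂ) • h := by rw [hf, hk, hg]; module
    simp only
    rw [e, hf, hk, hg, hh, map_smul]
    module
  · intro h
    simp only at h
    refine ⟨-f, f + f', mem_ofOp.2 (by simp), ⟨(2 : ℂ)⁻¹ • (f + f'), ?_, ?_⟩, ?_⟩
    · refine mem_ofOp.2 (?_ : f = (1 - T) ((2 : ℂ)⁻¹ • (f + f')))
      simp only [sub_apply, one_apply_eq_self, map_smul, ← h]
      module
    · simp only; module
    · simp

theorem inverseStieltjesTransform_eq_negInv (Ω : ℂ → M →L[ℂ] M) (l : ℂ) :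
    inverseStieltjesTransform Ω l = negInv (stieltjesTransform Ω l) := by
  rw [stieltjesTransform_eq_cayley]
  ext ⟨f, f'⟩
  rw [mem_negInv, mem_cayley_ofOp]
  unfold inverseStieltjesTransform
  generalize Ω ((1 + l) / (1 - l)) = T
  constructor
  · rintro ⟨g, k, hg, ⟨m, ⟨h, hh, hm⟩, hk⟩, hf⟩
    have hg : g = f := by simpa using mem_ofOp.1 hg
    have hh : f = h + T h := by simpa using mem_ofOp.1 (show (h, f) ∈ ofOp (1 + T) from hh)
    have hm : m = (2 : ℂ) • h := hm
    have hk : k = (-1 : ℂ) • m := hk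
    have hf : f' = g + k := hf
    have e : f' + -f = (-2 : ℂ) • h := by rw [hf, hk, hg, hm]; module
    simp only
    rw [e, hf, hk, hm, hg, hh, map_smul]
    module
  · intro h
    simp only at h
    refine ⟨f, f' - f, mem_ofOp.2 (by simp),
      ⟨f - f', ⟨(2 : ℂ)⁻¹ • (f - f'), ?_, ?_⟩, ?_⟩, ?_⟩
    · refine mem_ofOp.2 (?_ : f = (1 + T) ((2 : ℂ)⁻¹ • (f - f')))
      have h2 : T (f - f') = f + f' := by
        rw [← neg_sub, map_neg, sub_eq_add_neg, ← h]
        abel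
      simp only [add_apply, one_apply_eq_self, map_smul, h2]
      module
    · simp only; module
    · simp only; module
    · simp

theorem coe_stieltjesTransform (Ω : ℂ → M →L[ℂ] M) (l : ℂ) :
    (stieltjesTransform Ω l : Set (M × M)) =
      {p | ∃ h : M, p = ((1 - Ω ((1 + l) / (1 - l))) h, (1 + Ω ((1 + l) / (1 - l))) h)} := by
  ext p
  rw [SetLike.mem_coe, stieltjesTransform_eq_cayley, mem_cayley_ofOp_iff_exists]
  rfl

theorem coe_inverseStieltjesTransform (Ω : ℂ → M →L[ℂ] M) (l : ℂ) :
    (inverseStieltjesTransform Ω l : Set (M × M)) =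
      {p | ∃ h : M, p = ((1 + Ω ((1 + l) / (1 - l))) h, (Ω ((1 + l) / (1 - l)) - 1) h)} := by
  ext p
  rw [SetLike.mem_coe, inverseStieltjesTransform_eq_negInv, mem_negInv,
    stieltjesTransform_eq_cayley, mem_cayley_ofOp_iff_exists]
  constructor
  · rintro ⟨h, hh⟩
    obtain ⟨h1, h2⟩ := Prod.ext_iff.1 hh
    refine ⟨-h, Prod.ext ?_ ?_⟩
    · rw [map_neg]
      exact neg_eq_iff_eq_neg.1 h2
    · simp only
      rw [map_neg, ← neg_apply (Ω ((1 + l) / (1 - l)) - 1), neg_sub]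
      exact h1
  · rintro ⟨h, rfl⟩
    refine ⟨-h, Prod.ext ?_ ?_⟩
    · simp only
      rw [map_neg, ← neg_apply (1 - Ω ((1 + l) / (1 - l))), neg_sub]
    · simp [add_comm]

end Transforms

/-! ### The Möbius map between the cut plane and the doubly cut plane. -/

section HalfPlanes

theorem isOpen_upperHalf : IsOpen upperHalf := isOpen_lt continuous_const Complex.continuous_im

theorem isOpen_lowerHalf : IsOpen lowerHalf := isOpen_lt Complex.continuous_im continuous_const

theorem cutPlane_eq : cutPlane = {z | z.im ≠ 0} ∪ {z | z.re < 0} := by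
  ext z
  simp only [cutPlane, Set.mem_ofPred_eq, Set.mem_union, not_and_or, not_le, ne_eq]

theorem isOpen_cutPlane : IsOpen cutPlane := by
  rw [cutPlane_eq]
  exact (isOpen_ne_fun Complex.continuous_im continuous_const).union
    (isOpen_lt Complex.continuous_re continuous_const)

theorem isOpen_doublyCutPlane : IsOpen doublyCutPlane := by
  have : doublyCutPlane = {z : ℂ | z.im ≠ 0} ∪ ({z | -1 < z.re} ∩ {z | z.re < 1}) := by
    ext z
    simp only [doublyCutPlane, Set.mem_ofPred_eq, Set.mem_union, Set.mem_inter_iff, not_and_or,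
      not_or, not_le, ne_eq]
  rw [this]
  exact (isOpen_ne_fun Complex.continuous_im continuous_const).union
    ((isOpen_lt continuous_const Complex.continuous_re).inter
      (isOpen_lt Complex.continuous_re continuous_const))

theorem mem_cutPlane_iff {l : ℂ} : l ∈ cutPlane ↔ l ∈ upperHalf ∨ l ∈ lowerHalf ∨ l ∈ negAxis := by
  simp only [cutPlane, upperHalf, lowerHalf, negAxis, Set.mem_ofPred_eq]
  rcases lt_trichotomy l.im 0 with h | h | h
  · simp [h, h.ne]
  · simp [h]
  · simp [h, h.ne']

theorem upperHalf_union_negAxis_subset : upperHalf ∪ negAxis ⊆ cutPlane := fun _ hl =>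
  mem_cutPlane_iff.2 (hl.elim Or.inl fun h => Or.inr (Or.inr h))

theorem lowerHalf_union_negAxis_subset : lowerHalf ∪ negAxis ⊆ cutPlane := fun _ hl =>
  mem_cutPlane_iff.2 (Or.inr hl)

theorem mobius_im (l : ℂ) : ((1 + l) / (1 - l)).im = 2 * l.im / Complex.normSq (1 - l) := by
  rw [Complex.div_im]
  simp only [Complex.add_im, Complex.one_im, Complex.sub_re, Complex.one_re, Complex.add_re,
    Complex.sub_im]
  ring

theorem mobius_symm_im (z : ℂ) : ((z - 1) / (z + 1)).im = 2 * z.im / Complex.normSq (z + 1) := by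
  rw [Complex.div_im]
  simp only [Complex.add_im, Complex.one_im, Complex.sub_re, Complex.one_re, Complex.add_re,
    Complex.sub_im]
  ring

theorem mobius_mobius_symm {z : ℂ} (hz : z ≠ -1) :
    (1 + (z - 1) / (z + 1)) / (1 - (z - 1) / (z + 1)) = z := by
  have h1 : z + 1 ≠ 0 := fun h => hz (eq_neg_of_add_eq_zero_left h)
  have h2 : 1 - (z - 1) / (z + 1) ≠ 0 := by
    rw [one_sub_div h1]
    simpa using h1
  field_simp
  ring

theorem mobius_symm_mobius {l : ℂ} (hl : l ≠ 1) :
    ((1 + l) / (1 - l) - 1) / ((1 + l) / (1 - l) + 1) = l := by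
  have h1 : 1 - l ≠ 0 := sub_ne_zero.2 hl.symm
  have h2 : (1 + l) / (1 - l) + 1 ≠ 0 := by
    rw [div_add_one h1]
    simpa using h1
  field_simp
  ring

theorem ne_one_of_mem_cutPlane {l : ℂ} (hl : l ∈ cutPlane) : l ≠ 1 := by
  rintro rfl
  exact hl (by simp)

theorem ne_neg_one_of_mem_doublyCutPlane {z : ℂ} (hz : z ∈ doublyCutPlane) : z ≠ -1 := by
  rintro rfl
  exact hz (by simp)

theorem mobius_mem_upperHalf {l : ℂ} (hl : l ∈ upperHalf) : (1 + l) / (1 - l) ∈ upperHalf := by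
  have hl : 0 < l.im := hl
  have h1 : 1 - l ≠ 0 := by
    intro h
    rw [← sub_eq_zero.1 h] at hl
    simp at hl
  have := Complex.normSq_pos.2 h1
  change 0 < Complex.im _
  rw [mobius_im]
  positivity

theorem mobius_conj (l : ℂ) : (1 + conj l) / (1 - conj l) = conj ((1 + l) / (1 - l)) := by
  simp

theorem conj_mem_upperHalf {l : ℂ} : conj l ∈ upperHalf ↔ l ∈ lowerHalf := by
  simp [upperHalf, lowerHalf]

theorem mobius_mem_lowerHalf {l : ℂ} (hl : l ∈ lowerHalf) : (1 + l) / (1 - l) ∈ lowerHalf := by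
  rw [← conj_mem_upperHalf, ← mobius_conj]
  exact mobius_mem_upperHalf (conj_mem_upperHalf.2 hl)

theorem mobius_symm_mem_upperHalf {z : ℂ} (hz : z ∈ upperHalf) :
    (z - 1) / (z + 1) ∈ upperHalf := by
  have hz : 0 < z.im := hz
  have h1 : z + 1 ≠ 0 := by
    intro h
    rw [eq_neg_of_add_eq_zero_left h] at hz
    simp at hz
  have := Complex.normSq_pos.2 h1
  change 0 < Complex.im _
  rw [mobius_symm_im]
  positivity

theorem mobius_symm_mem_lowerHalf {z : ℂ} (hz : z ∈ lowerHalf) :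
    (z - 1) / (z + 1) ∈ lowerHalf := by
  rw [← conj_mem_upperHalf] at hz ⊢
  have := mobius_symm_mem_upperHalf hz
  simpa using this

theorem ofReal_mem_negAxis {x : ℝ} (hx : x < 0) : (x : ℂ) ∈ negAxis := by
  simp [negAxis, hx]

theorem exists_of_mem_negAxis {l : ℂ} (hl : l ∈ negAxis) : ∃ x : ℝ, x < 0 ∧ l = x :=
  ⟨l.re, hl.2, Complex.ext rfl (by simpa using hl.1)⟩

theorem mobius_of_mem_negAxis {l : ℂ} (hl : l ∈ negAxis) :
    ∃ r : ℝ, -1 < r ∧ r < 1 ∧ (1 + l) / (1 - l) = r := by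
  obtain ⟨x, hx, rfl⟩ := exists_of_mem_negAxis hl
  have h1 : 0 < 1 - x := by linarith
  refine ⟨(1 + x) / (1 - x), ?_, ?_, by push_cast; rfl⟩
  · rw [lt_div_iff₀ h1]; linarith
  · rw [div_lt_one h1]; linarith

theorem mobius_symm_mem_negAxis {r : ℝ} (h1 : -1 < r) (h2 : r < 1) :
    ((r : ℂ) - 1) / (r + 1) ∈ negAxis := by
  have : ((r : ℂ) - 1) / (r + 1) = ((r - 1) / (r + 1) : ℝ) := by push_cast; rfl
  rw [this]
  exact ofReal_mem_negAxis (div_neg_of_neg_of_pos (by linarith) (by linarith))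

theorem mobius_mem_doublyCutPlane {l : ℂ} (hl : l ∈ cutPlane) :
    (1 + l) / (1 - l) ∈ doublyCutPlane := by
  rw [doublyCutPlane, Set.mem_ofPred_eq]
  rcases mem_cutPlane_iff.1 hl with h | h | h
  · exact fun h' => (ne_of_gt (mobius_mem_upperHalf h)) h'.1
  · exact fun h' => (ne_of_lt (mobius_mem_lowerHalf h)) h'.1
  · obtain ⟨r, h1, h2, h3⟩ := mobius_of_mem_negAxis h
    rw [h3]
    simp [h1, h2]

theorem mobius_symm_mem_cutPlane {z : ℂ} (hz : z ∈ doublyCutPlane) :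
    (z - 1) / (z + 1) ∈ cutPlane := by
  rw [mem_cutPlane_iff]
  rcases lt_trichotomy z.im 0 with h | h | h
  · exact Or.inr (Or.inl (mobius_symm_mem_lowerHalf h))
  · obtain ⟨r, rfl⟩ : ∃ r : ℝ, z = r := ⟨z.re, Complex.ext rfl (by simpa using h)⟩
    simp only [doublyCutPlane, Set.mem_ofPred_eq, Complex.ofReal_im, Complex.ofReal_re, true_and,
      not_or, not_le] at hz
    exact Or.inr (Or.inr (mobius_symm_mem_negAxis hz.1 hz.2))
  · exact Or.inl (mobius_symm_mem_upperHalf h)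

end HalfPlanes

/-! ### Operator bounds, invertibility and analytic resolvents. -/

section Operators

variable {M : Type*} [NormedAddCommGroup M] [InnerProductSpace ℂ M]

theorem isSymmetric_of_inner_im_eq_zero {T : M →L[ℂ] M} (h : ∀ x, (inner ℂ x (T x)).im = 0) :
    (T : M →ₗ[ℂ] M).IsSymmetric := by
  rw [LinearMap.isSymmetric_iff_inner_map_self_real]
  intro v
  rw [Complex.conj_eq_iff_im, ← inner_conj_symm, Complex.conj_im, neg_eq_zero]
  exact h v

theorem neg_one_le_and_le_one_iff (T : M →L[ℂ] M) :
    (-1 ≤ T ∧ T ≤ 1) ↔ ∀ h, (inner ℂ h (T h)).im = 0 ∧ ‖T h‖ ≤ ‖h‖ := by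
  constructor
  · rintro ⟨h1, h2⟩
    rw [ContinuousLinearMap.le_def] at h1 h2
    have hT : (T : M →ₗ[ℂ] M).IsSymmetric := by
      have := (LinearMap.IsSymmetric.one (𝕜 := ℂ) (E := M)).sub h2.isSymmetric
      simpa using this
    intro h
    refine ⟨?_, ?_⟩
    · rw [← Complex.conj_eq_iff_im, inner_conj_symm]
      exact hT h h
    -- Since `(1 - T)(1 + T)(1 - T) + (1 + T)(1 - T)(1 + T) = 2 (1 - T²)`, the sum of the two
    -- inequalities is `0 ≤ 2 (‖h‖² - ‖T h‖²)`.
    · have a1 := h1.re_inner_nonneg_right (h - T h)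
      have a2 := h2.re_inner_nonneg_right (h + T h)
      have s₁ : inner ℂ (T h) h = inner ℂ h (T h) := hT h h
      have s₂ : inner ℂ h (T (T h)) = inner ℂ (T h) (T h) := (hT h (T h)).symm
      simp only [sub_neg_eq_add, add_apply, sub_apply, one_apply_eq_self, map_sub, map_add,
        inner_add_left, inner_add_right, inner_sub_left, inner_sub_right, s₁, s₂,
        inner_self_eq_norm_sq_to_K, RCLike.re_to_complex] at a1 a2
      have b1 : ((‖h‖ : ℂ) ^ 2).re = ‖h‖ ^ 2 := by norm_cast
      have b2 : ((‖T h‖ : ℂ) ^ 2).re = ‖T h‖ ^ 2 := by norm_cast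
      simp only [Complex.coe_algebraMap, b1, b2] at a1 a2
      refine (abs_le_of_sq_le_sq' (?_ : ‖T h‖ ^ 2 ≤ ‖h‖ ^ 2) (norm_nonneg _)).2
      linarith
  · intro H
    have hT := isSymmetric_of_inner_im_eq_zero fun x => (H x).1
    have hre : ∀ x, |(inner ℂ (T x) x).re| ≤ ‖x‖ ^ 2 := fun x => by
      calc |(inner ℂ (T x) x).re| ≤ ‖inner ℂ (T x) x‖ := Complex.abs_re_le_norm _
        _ ≤ ‖T x‖ * ‖x‖ := norm_inner_le_norm _ _
        _ ≤ ‖x‖ ^ 2 := by rw [sq]; gcongr; exact (H x).2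
    have hone : ∀ x : M, (inner ℂ x x).re = ‖x‖ ^ 2 := fun x => by
      rw [inner_self_eq_norm_sq_to_K]; norm_cast
    rw [ContinuousLinearMap.le_def, ContinuousLinearMap.le_def]
    refine ⟨⟨?_, fun x => ?_⟩, ⟨?_, fun x => ?_⟩⟩
    · simpa using hT.add (LinearMap.IsSymmetric.one (𝕜 := ℂ) (E := M))
    · rw [ContinuousLinearMap.reApplyInnerSelf_apply]
      simp only [sub_neg_eq_add, add_apply, one_apply_eq_self, inner_add_left,
        RCLike.re_to_complex, Complex.add_re, hone]
      linarith [neg_le_of_abs_le (hre x)]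
    · simpa using (LinearMap.IsSymmetric.one (𝕜 := ℂ) (E := M)).sub hT
    · rw [ContinuousLinearMap.reApplyInnerSelf_apply]
      simp only [sub_apply, one_apply_eq_self, inner_sub_left,
        RCLike.re_to_complex, Complex.sub_re, hone]
      linarith [le_of_abs_le (hre x)]

variable [CompleteSpace M]

/-- The imaginary part of the shifted form, multiplied by `ε`, is at least `‖x‖²`, so the numerical
range stays away from zero. -/
theorem isUnit_add_smul_I {T : M →L[ℂ] M} {ε : ℝ} (hε : ε ^ 2 = 1)
    (hT : ∀ x, 0 ≤ ε * (inner ℂ x (T x)).im) : IsUnit (T + (ε * Complex.I) • 1) := by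
  refine ContinuousLinearMap.isUnit_of_forall_le_norm_inner_map _ (c := 1) one_pos fun x => ?_
  rw [norm_inner_symm]
  have h1 : ε * (inner ℂ x ((T + (ε * Complex.I) • (1 : M →L[ℂ] M)) x)).im =
      ε * (inner ℂ x (T x)).im + ε ^ 2 * ‖x‖ ^ 2 := by
    simp only [add_apply, smul_apply, one_apply_eq_self, inner_add_right, inner_smul_right,
      inner_self_eq_norm_sq_to_K, Complex.coe_algebraMap]
    have : (ε * Complex.I * (‖x‖ : ℂ) ^ 2).im = ε * ‖x‖ ^ 2 := by
      rw [mul_right_comm]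
      have e : (ε : ℂ) * (‖x‖ : ℂ) ^ 2 = ((ε * ‖x‖ ^ 2 : ℝ) : ℂ) := by push_cast; rfl
      rw [e, Complex.mul_I_im, Complex.ofReal_re]
    rw [Complex.add_im, this]
    ring
  rw [hε] at h1
  have h2 : |ε| = 1 := by
    rwa [← sq_abs, pow_eq_one_iff_of_nonneg (abs_nonneg ε) two_ne_zero] at hε
  calc ‖x‖ ^ 2 * ((1 : NNReal) : ℝ)
      ≤ ε * (inner ℂ x ((T + (ε * Complex.I) • (1 : M →L[ℂ] M)) x)).im := by
        rw [h1]; have := hT x; simp; linarith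
    _ ≤ |ε * (inner ℂ x ((T + (ε * Complex.I) • (1 : M →L[ℂ] M)) x)).im| := le_abs_self _
    _ ≤ _ := by rw [abs_mul, h2, one_mul]; exact Complex.abs_im_le_norm _

theorem AnalyticAt.ringInverse {A : Type*} [NormedRing A] [NormedAlgebra ℂ A] [CompleteSpace A]
    {f : ℂ → A} {l : ℂ} (hf : AnalyticAt ℂ f l) (hu : IsUnit (f l)) :
    AnalyticAt ℂ (fun w => Ring.inverse (f w)) l := by
  obtain ⟨u, hu⟩ := hu
  exact AnalyticAt.fun_comp (by rw [← hu]; exact analyticAt_inverse u) hf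

/-- Analyticity of the resolvents at `-ε i`, `ε = ±1`, of a bounded analytic function whose
imaginary part has the sign of `ε`. -/
theorem resolventAnalyticOn_ofOp {ω : ℂ → M →L[ℂ] M} {S : Set ℂ} {ε : ℝ} (hε : ε ^ 2 = 1)
    (hω : AnalyticOnNhd ℂ ω S) (him : ∀ l ∈ S, ∀ x, 0 ≤ ε * (inner ℂ x (ω l x)).im) :
    ResolventAnalyticOn (fun l => ofOp (ω l)) (ε * Complex.I) S := by
  have hu := fun l hl => isUnit_add_smul_I hε (him l hl)
  refine ⟨fun l => Ring.inverse (ω l + (ε * Complex.I) • 1), fun l hl => ?_, fun l hl => ?_⟩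
  · exact ((hω l hl).add analyticAt_const).ringInverse (hu l hl)
  · exact shiftInv_ofOp (Ring.mul_inverse_cancel _ (hu l hl)) (Ring.inverse_mul_cancel _ (hu l hl))

theorem resolventAnalyticOn_cayley_ofOp {ω : ℂ → M →L[ℂ] M} {S : Set ℂ} {ε : ℝ} (hε : ε ^ 2 = 1)
    (hω : AnalyticOnNhd ℂ ω S) (him : ∀ l ∈ S, ∀ x, 0 ≤ ε * (inner ℂ x (ω l x)).im) :
    ResolventAnalyticOn (fun l => cayley (ofOp (ω l))) (ε * Complex.I) S := by
  set μ : ℂ := ε * Complex.I with hμ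
  have hμ2 : μ * μ = -1 := by
    rw [hμ, mul_mul_mul_comm, Complex.I_mul_I]
    norm_cast
    simp [← sq, hε]
  have hμ1 : 1 - μ ≠ 0 := by
    intro h
    rw [← sub_eq_zero.1 h] at hμ2
    norm_num at hμ2
  have hu : ∀ l ∈ S, IsUnit ((1 + μ) • (1 : M →L[ℂ] M) + (1 - μ) • ω l) := by
    intro l hl
    -- The choice `μ = ± i` enters here: `μ² = -1` gives `1 + μ = (1 - μ) μ`.
    have e : (1 + μ) • (1 : M →L[ℂ] M) + (1 - μ) • ω l = (1 - μ) • (ω l + μ • 1) := by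
      rw [smul_add, smul_smul, sub_mul, hμ2, add_comm]
      congr 2
      ring
    rw [e]
    exact (isUnit_add_smul_I hε (him l hl)).smul (Units.mk0 _ hμ1)
  refine ⟨fun l => (1 - ω l) * Ring.inverse ((1 + μ) • 1 + (1 - μ) • ω l), fun l hl => ?_,
    fun l hl => ?_⟩
  · have h1 : AnalyticAt ℂ (fun l => 1 - ω l) l := analyticAt_const.sub (hω l hl)
    have h2 : AnalyticAt ℂ (fun l => (1 + μ) • (1 : M →L[ℂ] M) + (1 - μ) • ω l) l :=
      analyticAt_const.add (analyticAt_const.fun_smul (hω l hl))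
    exact h1.mul (h2.ringInverse (hu l hl))
  · exact shiftInv_cayley_ofOp (Ring.mul_inverse_cancel _ (hu l hl))
      (Ring.inverse_mul_cancel _ (hu l hl))

end Operators

/-! ### Nevanlinna and Stieltjes families under the involution and the transform. -/

section Families

variable {M : Type*} [NormedAddCommGroup M] [InnerProductSpace ℂ M]

theorem neg_inv_mem_upperHalf {μ : ℂ} (hμ : μ ∈ upperHalf) : -μ⁻¹ ∈ upperHalf := by
  have hμ : 0 < μ.im := hμ
  have h0 : 0 < Complex.normSq μ := Complex.normSq_pos.2 (by rintro rfl; simp at hμ)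
  change 0 < (-μ⁻¹).im
  rw [Complex.neg_im, Complex.inv_im, neg_div, neg_neg]
  positivity

theorem neg_inv_mem_lowerHalf {μ : ℂ} (hμ : μ ∈ lowerHalf) : -μ⁻¹ ∈ lowerHalf := by
  rw [← conj_mem_upperHalf] at hμ ⊢
  have := neg_inv_mem_upperHalf hμ
  simpa using this

theorem ne_zero_of_mem_upperHalf {μ : ℂ} (hμ : μ ∈ upperHalf) : μ ≠ 0 := by
  rintro rfl
  exact lt_irrefl _ (show (0 : ℝ) < 0 from hμ)

theorem ne_zero_of_mem_lowerHalf {μ : ℂ} (hμ : μ ∈ lowerHalf) : μ ≠ 0 := by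
  rintro rfl
  exact lt_irrefl _ (show (0 : ℝ) < 0 from hμ)

theorem ResolventAnalyticOn.negInv {𝓜 : ℂ → LinRel M} {μ : ℂ} {S : Set ℂ} (hμ : μ ≠ 0)
    (h : ResolventAnalyticOn 𝓜 μ S) :
    ResolventAnalyticOn (fun l => LinRel.negInv (𝓜 l)) (-μ⁻¹) S := by
  obtain ⟨F, hF, hF'⟩ := h
  refine ⟨fun l => -μ • (1 - μ • F l), fun l hl => ?_, fun l hl => shiftInv_negInv hμ (hF' l hl)⟩
  exact analyticAt_const.fun_smul (analyticAt_const.sub (analyticAt_const.fun_smul (hF l hl)))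

theorem ResolventAnalyticOn.negInv_upper {𝓜 : ℂ → LinRel M} {S : Set ℂ}
    (h : ∃ μ ∈ upperHalf, ResolventAnalyticOn 𝓜 μ S) :
    ∃ μ ∈ upperHalf, ResolventAnalyticOn (fun l => LinRel.negInv (𝓜 l)) μ S := by
  obtain ⟨μ, hμ, h⟩ := h
  exact ⟨_, neg_inv_mem_upperHalf hμ, h.negInv (ne_zero_of_mem_upperHalf hμ)⟩

theorem ResolventAnalyticOn.negInv_lower {𝓜 : ℂ → LinRel M} {S : Set ℂ}
    (h : ∃ μ ∈ lowerHalf, ResolventAnalyticOn 𝓜 μ S) :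
    ∃ μ ∈ lowerHalf, ResolventAnalyticOn (fun l => LinRel.negInv (𝓜 l)) μ S := by
  obtain ⟨μ, hμ, h⟩ := h
  exact ⟨_, neg_inv_mem_lowerHalf hμ, h.negInv (ne_zero_of_mem_lowerHalf hμ)⟩

theorem ResolventAnalyticOn.congr {𝓜 𝓛 : ℂ → LinRel M} {μ : ℂ} {S : Set ℂ}
    (h : ResolventAnalyticOn 𝓜 μ S) (he : ∀ l ∈ S, 𝓜 l = 𝓛 l) :
    ResolventAnalyticOn 𝓛 μ S := by
  obtain ⟨F, hF, hF'⟩ := h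
  exact ⟨F, hF, fun l hl => he l hl ▸ hF' l hl⟩

/-- If the Cayley-type transforms of `ω` have analytic resolvents on `S`, then `ω` extends
analytically to a neighbourhood of `S`. -/
theorem ResolventAnalyticOn.exists_analyticOnNhd [CompleteSpace M] {ω : ℂ → M →L[ℂ] M} {μ : ℂ}
    {S : Set ℂ} (h : ResolventAnalyticOn (fun l => cayley (ofOp (ω l))) μ S) :
    ∃ Φ : ℂ → M →L[ℂ] M, AnalyticOnNhd ℂ Φ S ∧ ∀ l ∈ S, ω l = Φ l := by
  obtain ⟨F, hF, hF'⟩ := h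
  refine ⟨fun l => Ring.inverse (1 + (1 - μ) • F l) * (1 - (1 + μ) • F l), fun l hl => ?_,
    fun l hl => eq_of_shiftInv_cayley_ofOp (hF' l hl)⟩
  have h1 : AnalyticAt ℂ (fun l => 1 + (1 - μ) • F l) l :=
    analyticAt_const.add (analyticAt_const.fun_smul (hF l hl))
  have h2 : AnalyticAt ℂ (fun l => 1 - (1 + μ) • F l) l :=
    analyticAt_const.sub (analyticAt_const.fun_smul (hF l hl))
  exact (h1.ringInverse (isUnit_of_cayley_ofOp (hF' l hl))).mul h2

theorem frequently_mem_negAxis {l : ℂ} (hl : l ∈ negAxis) : ∃ᶠ w in 𝓝[≠] l, w ∈ negAxis := by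
  obtain ⟨x, hx, rfl⟩ := exists_of_mem_negAxis hl
  have ht : Tendsto (fun t : ℝ => (t : ℂ)) (𝓝[≠] x) (𝓝[≠] (x : ℂ)) :=
    tendsto_nhdsWithin_of_tendsto_nhds_of_eventually_within _
      (Complex.continuous_ofReal.continuousAt.tendsto.mono_left nhdsWithin_le_nhds)
      (eventually_nhdsWithin_of_forall fun t ht => by simpa using ht)
  refine ht.frequently (Eventually.frequently ?_)
  filter_upwards [nhdsWithin_le_nhds (Iio_mem_nhds hx)] with t ht using ofReal_mem_negAxis ht

/-- A function that extends analytically to `(-∞, 0)` from the closed upper side and from the closed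
lower side is analytic on the cut plane. -/
theorem analyticOnNhd_cutPlane {E : Type*} [NormedAddCommGroup E] [NormedSpace ℂ E]
    {ω Φ Ψ : ℂ → E} (hΦ : AnalyticOnNhd ℂ Φ (upperHalf ∪ negAxis))
    (hΦω : ∀ l ∈ upperHalf ∪ negAxis, ω l = Φ l)
    (hΨ : AnalyticOnNhd ℂ Ψ (lowerHalf ∪ negAxis))
    (hΨω : ∀ l ∈ lowerHalf ∪ negAxis, ω l = Ψ l) : AnalyticOnNhd ℂ ω cutPlane := by
  intro l hl
  rcases mem_cutPlane_iff.1 hl with h | h | h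
  · refine (hΦ l (Or.inl h)).congr ?_
    filter_upwards [isOpen_upperHalf.mem_nhds h] with w hw using (hΦω w (Or.inl hw)).symm
  · refine (hΨ l (Or.inl h)).congr ?_
    filter_upwards [isOpen_lowerHalf.mem_nhds h] with w hw using (hΨω w (Or.inl hw)).symm
  -- Both continuations equal `ω` on the negative axis, which accumulates at `l`, so the identity
  -- theorem glues them.
  · have h1 : ∀ᶠ w in 𝓝 l, Φ w = Ψ w := by
      refine (AnalyticAt.frequently_eq_iff_eventually_eq (hΦ l (Or.inr h)) (hΨ l (Or.inr h))).1 ?_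
      refine (frequently_mem_negAxis h).mono fun w hw => ?_
      rw [← hΦω w (Or.inr hw), ← hΨω w (Or.inr hw)]
    refine (hΦ l (Or.inr h)).congr ?_
    filter_upwards [isOpen_cutPlane.mem_nhds hl, h1] with w hw hw'
    rcases mem_cutPlane_iff.1 hw with h | h | h
    · exact (hΦω w (Or.inl h)).symm
    · exact hw'.trans (hΨω w (Or.inl h)).symm
    · exact (hΦω w (Or.inr h)).symm

variable [CompleteSpace M]

theorem IsNevanlinnaFamily.negInv {𝓜 : ℂ → LinRel M} (h : IsNevanlinnaFamily 𝓜) :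
    IsNevanlinnaFamily fun l => LinRel.negInv (𝓜 l) where
  dissipative l hl :=
    (LinRel.negInv.maximal_apply_iff isDissipative_negInv _).2 (h.dissipative l hl)
  accumulative l hl :=
    (LinRel.negInv.maximal_apply_iff isAccumulative_negInv _).2 (h.accumulative l hl)
  adjoint_eq l hl := by rw [adjoint_negInv, h.adjoint_eq l hl]
  holomorphic_upper := ResolventAnalyticOn.negInv_upper h.holomorphic_upper
  holomorphic_lower := ResolventAnalyticOn.negInv_lower h.holomorphic_lower

theorem IsStieltjesFamily.negInv {𝓜 : ℂ → LinRel M} (h : IsStieltjesFamily 𝓜) :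
    IsInverseStieltjesFamily fun l => LinRel.negInv (𝓜 l) where
  nevanlinna := h.nevanlinna.negInv
  nonpos x hx := (isNonpos_negInv _).2 (h.nonneg x hx)
  continuation_upper := ResolventAnalyticOn.negInv_upper h.continuation_upper
  continuation_lower := ResolventAnalyticOn.negInv_lower h.continuation_lower

theorem IsInverseStieltjesFamily.negInv {𝓜 : ℂ → LinRel M} (h : IsInverseStieltjesFamily 𝓜) :
    IsStieltjesFamily fun l => LinRel.negInv (𝓜 l) where
  nevanlinna := h.nevanlinna.negInv
  nonneg x hx := (isNonneg_negInv _).2 (h.nonpos x hx)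
  continuation_upper := ResolventAnalyticOn.negInv_upper h.continuation_upper
  continuation_lower := ResolventAnalyticOn.negInv_lower h.continuation_lower

theorem isStieltjesFamily_iff_negInv (𝓜 : ℂ → LinRel M) :
    IsStieltjesFamily 𝓜 ↔ IsInverseStieltjesFamily fun l => LinRel.negInv (𝓜 l) := by
  refine ⟨IsStieltjesFamily.negInv, fun h => ?_⟩
  simpa only [negInv_negInv] using h.negInv

theorem IsStieltjesFamily.congr {𝓜 𝓛 : ℂ → LinRel M} (h : IsStieltjesFamily 𝓜)
    (he : ∀ l ∈ cutPlane, 𝓜 l = 𝓛 l) : IsStieltjesFamily 𝓛 := by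
  have hu : ∀ l ∈ upperHalf, 𝓜 l = 𝓛 l := fun l hl => he l (mem_cutPlane_iff.2 (Or.inl hl))
  have hl : ∀ l ∈ lowerHalf, 𝓜 l = 𝓛 l := fun l hl =>
    he l (mem_cutPlane_iff.2 (Or.inr (Or.inl hl)))
  have hn : ∀ l ∈ negAxis, 𝓜 l = 𝓛 l := fun l hl =>
    he l (mem_cutPlane_iff.2 (Or.inr (Or.inr hl)))
  have him : ∀ l : ℂ, l.im ≠ 0 → 𝓜 l = 𝓛 l := fun l hl => he l fun h => hl h.1
  refine ⟨⟨fun l h' => hu l h' ▸ h.nevanlinna.dissipative l h',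
    fun l h' => hl l h' ▸ h.nevanlinna.accumulative l h', fun l h' => ?_, ?_, ?_⟩,
    fun l h' => hn l h' ▸ h.nonneg l h', ?_, ?_⟩
  · rw [← him l h', ← him _ (by simpa using h')]
    exact h.nevanlinna.adjoint_eq l h'
  · obtain ⟨μ, hμ, h⟩ := h.nevanlinna.holomorphic_upper
    exact ⟨μ, hμ, h.congr hu⟩
  · obtain ⟨μ, hμ, h⟩ := h.nevanlinna.holomorphic_lower
    exact ⟨μ, hμ, h.congr hl⟩
  · obtain ⟨μ, hμ, h⟩ := h.continuation_upper
    exact ⟨μ, hμ, h.congr fun l hl => he l (upperHalf_union_negAxis_subset hl)⟩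
  · obtain ⟨μ, hμ, h⟩ := h.continuation_lower
    exact ⟨μ, hμ, h.congr fun l hl => he l (lowerHalf_union_negAxis_subset hl)⟩

theorem I_mem_upperHalf : ((1 : ℝ) : ℂ) * Complex.I ∈ upperHalf := by
  simp [upperHalf]

theorem neg_I_mem_lowerHalf : ((-1 : ℝ) : ℂ) * Complex.I ∈ lowerHalf := by
  simp [lowerHalf]

theorem IsNevanlinnaSchur.isStieltjesFamily {Ω : ℂ → M →L[ℂ] M} (h : IsNevanlinnaSchur Ω) :
    IsStieltjesFamily (stieltjesTransform Ω) := by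
  rw [funext (stieltjesTransform_eq_cayley Ω)]
  have hω : AnalyticOnNhd ℂ (fun l => Ω ((1 + l) / (1 - l))) cutPlane := by
    refine DifferentiableOn.analyticOnNhd ?_ isOpen_cutPlane
    refine h.holomorphic.comp (fun l hl => ?_) fun l hl => mobius_mem_doublyCutPlane hl
    refine DifferentiableAt.differentiableWithinAt ?_
    have : 1 - l ≠ 0 := sub_ne_zero.2 (ne_one_of_mem_cutPlane hl).symm
    fun_prop (disch := assumption)
  have hreal : ∀ l ∈ negAxis, ∀ x, (inner ℂ x (Ω ((1 + l) / (1 - l)) x)).im = 0 ∧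
      ‖Ω ((1 + l) / (1 - l)) x‖ ≤ ‖x‖ := by
    intro l hl
    obtain ⟨r, h1, h2, h3⟩ := mobius_of_mem_negAxis hl
    rw [h3]
    exact (neg_one_le_and_le_one_iff _).1 (h.bounds r h1 h2)
  have hup : ∃ μ ∈ upperHalf, ResolventAnalyticOn
      (fun l => cayley (ofOp (Ω ((1 + l) / (1 - l))))) μ (upperHalf ∪ negAxis) := by
    refine ⟨_, I_mem_upperHalf, resolventAnalyticOn_cayley_ofOp (by norm_num)
      (hω.mono upperHalf_union_negAxis_subset) fun l hl x => ?_⟩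
    rw [one_mul]
    rcases hl with hl | hl
    · exact (h.nevanlinna.dissipative _ (mobius_mem_upperHalf hl)).1 (x, _) (mem_ofOp.2 rfl)
    · exact (hreal l hl x).1.ge
  have hlow : ∃ μ ∈ lowerHalf, ResolventAnalyticOn
      (fun l => cayley (ofOp (Ω ((1 + l) / (1 - l))))) μ (lowerHalf ∪ negAxis) := by
    refine ⟨_, neg_I_mem_lowerHalf, resolventAnalyticOn_cayley_ofOp (by norm_num)
      (hω.mono lowerHalf_union_negAxis_subset) fun l hl x => ?_⟩
    rw [neg_one_mul, Left.nonneg_neg_iff]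
    rcases hl with hl | hl
    · exact (h.nevanlinna.accumulative _ (mobius_mem_lowerHalf hl)).1 (x, _) (mem_ofOp.2 rfl)
    · exact (hreal l hl x).1.le
  refine ⟨⟨fun l hl => ?_, fun l hl => ?_, fun l hl => ?_, ?_, ?_⟩, fun l hl => ?_, hup, hlow⟩
  · exact (cayley.maximal_apply_iff isDissipative_cayley _).2
      (h.nevanlinna.dissipative _ (mobius_mem_upperHalf hl))
  · exact (cayley.maximal_apply_iff isAccumulative_cayley _).2
      (h.nevanlinna.accumulative _ (mobius_mem_lowerHalf hl))
  · have h1 : ((1 + l) / (1 - l)).im ≠ 0 := by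
      rcases lt_or_gt_of_ne hl with hl | hl
      · exact ne_of_lt (mobius_mem_lowerHalf hl)
      · exact ne_of_gt (mobius_mem_upperHalf hl)
    rw [adjoint_cayley, mobius_conj]
    exact congrArg cayley (h.nevanlinna.adjoint_eq _ h1)
  · obtain ⟨μ, hμ, F, hF, hF'⟩ := hup
    exact ⟨μ, hμ, F, hF.mono Set.subset_union_left, fun l hl => hF' l (Or.inl hl)⟩
  · obtain ⟨μ, hμ, F, hF, hF'⟩ := hlow
    exact ⟨μ, hμ, F, hF.mono Set.subset_union_left, fun l hl => hF' l (Or.inl hl)⟩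
  · exact (isNonneg_cayley_ofOp _).2 (hreal l hl)

theorem IsNevanlinnaSchur.of_isStieltjesFamily {Ω : ℂ → M →L[ℂ] M}
    (h : IsStieltjesFamily (stieltjesTransform Ω)) : IsNevanlinnaSchur Ω := by
  rw [funext (stieltjesTransform_eq_cayley Ω)] at h
  have hω : AnalyticOnNhd ℂ (fun l => Ω ((1 + l) / (1 - l))) cutPlane := by
    obtain ⟨μ, -, hμ⟩ := h.continuation_upper
    obtain ⟨ν, -, hν⟩ := h.continuation_lower
    obtain ⟨Φ, hΦ, hΦω⟩ := hμ.exists_analyticOnNhd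
    obtain ⟨Ψ, hΨ, hΨω⟩ := hν.exists_analyticOnNhd
    exact analyticOnNhd_cutPlane hΦ hΦω hΨ hΨω
  have hz : ∀ z ∈ doublyCutPlane,
      (1 + (z - 1) / (z + 1)) / (1 - (z - 1) / (z + 1)) = z := fun z hz =>
    mobius_mobius_symm (ne_neg_one_of_mem_doublyCutPlane hz)
  have him : ∀ z : ℂ, z.im ≠ 0 → z ∈ doublyCutPlane := fun z hz h => hz h.1
  have hdiff : DifferentiableOn ℂ Ω doublyCutPlane := by
    have h1 : DifferentiableOn ℂ (fun z => Ω ((1 + (z - 1) / (z + 1)) / (1 - (z - 1) / (z + 1))))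
        doublyCutPlane := by
      refine hω.differentiableOn.comp (g := fun l => Ω ((1 + l) / (1 - l)))
        (f := fun z => (z - 1) / (z + 1)) (fun z hz => ?_) fun z hz => mobius_symm_mem_cutPlane hz
      refine DifferentiableAt.differentiableWithinAt ?_
      have : z + 1 ≠ 0 := fun h =>
        ne_neg_one_of_mem_doublyCutPlane hz (eq_neg_of_add_eq_zero_left h)
      fun_prop (disch := assumption)
    exact h1.congr fun z h' => by rw [hz z h']
  have hdiss : ∀ z ∈ upperHalf, Maximal IsDissipative (ofOp (Ω z)) := fun z h' => by
    have := (cayley.maximal_apply_iff isDissipative_cayley _).1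
      (h.nevanlinna.dissipative _ (mobius_symm_mem_upperHalf h'))
    rwa [hz z (him z (ne_of_gt h'))] at this
  have hacc : ∀ z ∈ lowerHalf, Maximal IsAccumulative (ofOp (Ω z)) := fun z h' => by
    have := (cayley.maximal_apply_iff isAccumulative_cayley _).1
      (h.nevanlinna.accumulative _ (mobius_symm_mem_lowerHalf h'))
    rwa [hz z (him z (ne_of_lt h'))] at this
  have han : AnalyticOnNhd ℂ Ω doublyCutPlane := hdiff.analyticOnNhd isOpen_doublyCutPlane
  refine ⟨⟨hdiss, hacc, fun z h' => ?_, ?_, ?_⟩, hdiff, fun r h1 h2 => ?_⟩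
  · have h1 : ((z - 1) / (z + 1)).im ≠ 0 := by
      rcases lt_or_gt_of_ne h' with h' | h'
      · exact ne_of_lt (mobius_symm_mem_lowerHalf h')
      · exact ne_of_gt (mobius_symm_mem_upperHalf h')
    have := h.nevanlinna.adjoint_eq _ h1
    rw [adjoint_cayley, mobius_conj, hz z (him z h')] at this
    exact cayley.injective this
  · refine ⟨_, I_mem_upperHalf, resolventAnalyticOn_ofOp (by norm_num)
      (han.mono fun z hz => him z (ne_of_gt hz)) fun z hz x => ?_⟩
    rw [one_mul]
    exact (hdiss z hz).1 (x, _) (mem_ofOp.2 rfl)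
  · refine ⟨_, neg_I_mem_lowerHalf, resolventAnalyticOn_ofOp (by norm_num)
      (han.mono fun z hz => him z (ne_of_lt hz)) fun z hz x => ?_⟩
    rw [neg_one_mul, Left.nonneg_neg_iff]
    exact (hacc z hz).1 (x, _) (mem_ofOp.2 rfl)
  · have h3 := (isNonneg_cayley_ofOp _).1 (h.nonneg _ (mobius_symm_mem_negAxis h1 h2))
    rw [mobius_mobius_symm fun h' => h1.ne' (by simpa using congrArg Complex.re h')] at h3
    exact (neg_one_le_and_le_one_iff _).2 h3

end Families

/-! ### Harnack's inequality in the disc and the upper half-plane. -/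

section Harnack

/-- The disc parametrisation of the upper half-plane that sends `0` to `a`. -/
theorem upperHalf_of_unitBall {a w : ℂ} (ha : a ∈ upperHalf) (hw : ‖w‖ < 1) :
    (a - conj a * w) / (1 - w) ∈ upperHalf := by
  have ha : 0 < a.im := ha
  have h1 : 1 - w ≠ 0 := by
    intro h
    rw [← sub_eq_zero.1 h] at hw
    simp at hw
  have h2 := Complex.normSq_pos.2 h1
  have h3 : Complex.normSq w < 1 := by
    rw [Complex.normSq_eq_norm_sq]
    exact pow_lt_one₀ (norm_nonneg _) hw two_ne_zero
  have e : ((a - conj a * w) / (1 - w)).im =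
      a.im * (1 - Complex.normSq w) / Complex.normSq (1 - w) := by
    rw [Complex.div_im, Complex.normSq_apply w]
    simp only [Complex.sub_im, Complex.mul_im, Complex.conj_re, Complex.conj_im, Complex.sub_re,
      Complex.one_re, Complex.mul_re, Complex.one_im]
    ring
  change 0 < Complex.im _
  rw [e]
  exact div_pos (mul_pos ha (by linarith)) h2

theorem norm_sub_lt_norm_sub_conj {a l : ℂ} (ha : a ∈ upperHalf) (hl : l ∈ upperHalf) :
    ‖l - a‖ < ‖l - conj a‖ := by
  have ha : 0 < a.im := ha
  have hl : 0 < l.im := hl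
  refine lt_of_pow_lt_pow_left₀ 2 (norm_nonneg _) ?_
  rw [← Complex.normSq_eq_norm_sq, ← Complex.normSq_eq_norm_sq, Complex.normSq_apply,
    Complex.normSq_apply]
  simp only [Complex.sub_re, Complex.sub_im, Complex.conj_re, Complex.conj_im]
  nlinarith [mul_pos ha hl]

theorem norm_sub_le_norm_add_conj {a b : ℂ} (ha : 0 ≤ a.re) (hb : 0 ≤ b.re) :
    ‖a - b‖ ≤ ‖a + conj b‖ := by
  refine le_of_sq_le_sq ?_ (norm_nonneg _)
  rw [← Complex.normSq_eq_norm_sq, ← Complex.normSq_eq_norm_sq, Complex.normSq_apply,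
    Complex.normSq_apply]
  simp only [Complex.sub_re, Complex.sub_im, Complex.add_re, Complex.add_im, Complex.conj_re,
    Complex.conj_im]
  nlinarith [mul_nonneg ha hb]

/-- Both sides of the squared hypothesis contain `(Im a - Im b)²`, on the right with factor `r² ≤
1`, so the imaginary parts drop out. -/
theorem re_sub_le_of_norm_sub_le {a b : ℂ} {r : ℝ} (hr : 0 ≤ r) (hr1 : r ≤ 1) (ha : 0 ≤ a.re)
    (hb : 0 ≤ b.re) (h : ‖a - b‖ ≤ r * ‖a + conj b‖) : a.re - b.re ≤ r * (a.re + b.re) := by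
  have h2 := pow_le_pow_left₀ (norm_nonneg _) h 2
  rw [mul_pow, ← Complex.normSq_eq_norm_sq, ← Complex.normSq_eq_norm_sq, Complex.normSq_apply,
    Complex.normSq_apply] at h2
  simp only [Complex.sub_re, Complex.sub_im, Complex.add_re, Complex.add_im, Complex.conj_re,
    Complex.conj_im] at h2
  have hr2 : r ^ 2 ≤ 1 := pow_le_one₀ hr hr1
  have h3 : (a.re - b.re) ^ 2 ≤ (r * (a.re + b.re)) ^ 2 := by
    nlinarith [mul_self_nonneg (a.im - b.im),
      mul_nonneg (sub_nonneg.2 hr2) (mul_self_nonneg (a.im - b.im))]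
  exact (abs_le_of_sq_le_sq' h3 (by positivity)).2

/-- **Harnack's inequality** in the disc for the real part of a holomorphic function. -/
theorem harnack_unitBall {p : ℂ → ℂ} (hp : DifferentiableOn ℂ p (Metric.ball 0 1))
    (hre : ∀ w ∈ Metric.ball (0 : ℂ) 1, 0 ≤ (p w).re) {w : ℂ} (hw : w ∈ Metric.ball (0 : ℂ) 1) :
    (1 - ‖w‖) * (p w).re ≤ (1 + ‖w‖) * (p 0).re := by
  have h0 : (0 : ℂ) ∈ Metric.ball (0 : ℂ) 1 := by simp
  have hw1 : ‖w‖ < 1 := by simpa using hw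
  have key : ∀ ε > 0, (p w).re - (p 0).re ≤ ‖w‖ * ((p w).re + (p 0).re + 2 * ε) := by
    intro ε hε
    -- Adding `ε` makes the real part strictly positive, so the denominator below cannot vanish.
    set P : ℂ → ℂ := fun w => p w + (ε : ℂ) with hP
    have hPre : ∀ w ∈ Metric.ball (0 : ℂ) 1, 0 < (P w).re := fun w hw => by
      have := hre w hw
      simp only [hP, Complex.add_re, Complex.ofReal_re]
      linarith
    have hne : ∀ w ∈ Metric.ball (0 : ℂ) 1, P w + conj (P 0) ≠ 0 := fun w hw h => by
      have := congrArg Complex.re h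
      simp only [Complex.add_re, Complex.conj_re, Complex.zero_re] at this
      linarith [hPre w hw, hPre 0 h0]
    have hd : DifferentiableOn ℂ P (Metric.ball 0 1) := hp.add_const _
    -- This quotient maps the disc into the closed unit disc and vanishes at `0`; the Schwarz lemma
    -- bounds it by `‖w‖`.
    have hq : DifferentiableOn ℂ (fun w => (P w - P 0) / (P w + conj (P 0)))
        (Metric.ball 0 1) := (hd.sub_const _).fun_div (hd.add_const _) hne
    have h1 := Complex.dist_le_div_mul_dist_of_mapsTo_ball (R₂ := 1) hq (fun v hv => by
      simp only [sub_self, zero_div, mem_closedBall_zero_iff, norm_div]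
      exact div_le_one_of_le₀ (norm_sub_le_norm_add_conj (hPre v hv).le (hPre 0 h0).le)
        (norm_nonneg _)) hw
    simp only [sub_self, zero_div, dist_zero_right, norm_div, div_one, one_mul] at h1
    rw [div_le_iff₀ (norm_pos_iff.2 (hne w hw))] at h1
    have h2 := re_sub_le_of_norm_sub_le (norm_nonneg w) hw1.le (hPre w hw).le (hPre 0 h0).le h1
    simp only [hP, Complex.add_re, Complex.ofReal_re] at h2
    linarith
  have hlim : (p w).re - (p 0).re ≤ ‖w‖ * ((p w).re + (p 0).re) := by
    refine le_of_forall_pos_le_add fun ε hε => ?_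
    have h1 := key (ε / 2) (by positivity)
    nlinarith [mul_le_mul_of_nonneg_right hw1.le hε.le]
  linarith

/-- **Harnack's inequality** in the upper half-plane, with a constant that depends on the two points
only. -/
theorem harnack_upperHalf {a l : ℂ} (ha : a ∈ upperHalf) (hl : l ∈ upperHalf) :
    ∃ c > 0, ∀ p : ℂ → ℂ, DifferentiableOn ℂ p upperHalf → (∀ w ∈ upperHalf, 0 ≤ (p w).re) →
      c * (p l).re ≤ (p a).re := by
  have h1 := norm_sub_lt_norm_sub_conj ha hl
  have h2 : l - conj a ≠ 0 := norm_pos_iff.1 ((norm_nonneg _).trans_lt h1)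
  -- The point of the disc corresponding to `l` when `a` corresponds to the centre.
  set w₀ := (l - a) / (l - conj a) with hw₀
  have hw : ‖w₀‖ < 1 := by
    rw [hw₀, norm_div]
    exact (div_lt_one (norm_pos_iff.2 h2)).2 h1
  have hlast : (a - conj a * w₀) / (1 - w₀) = l := by
    have h3 : a - conj a ≠ 0 := by
      intro h
      have h4 := congrArg Complex.im h
      have h5 : 0 < a.im := ha
      simp only [Complex.sub_im, Complex.conj_im, Complex.zero_im] at h4
      linarith
    have h4 : 1 - w₀ = (a - conj a) / (l - conj a) := by
      rw [hw₀, one_sub_div h2]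
      ring
    rw [h4, hw₀]
    field_simp
    ring
  refine ⟨(1 - ‖w₀‖) / (1 + ‖w₀‖), div_pos (by linarith) (by positivity), fun p hp hre => ?_⟩
  have h3 := harnack_unitBall (p := fun w => p ((a - conj a * w) / (1 - w))) (w := w₀) ?_
    (fun w hw => hre _ (upperHalf_of_unitBall ha (by simpa using hw))) (by simpa using hw)
  · simp only [hlast, mul_zero, sub_zero, div_one] at h3
    rw [div_mul_eq_mul_div, div_le_iff₀ (by positivity)]
    linarith
  · refine hp.comp (f := fun w => (a - conj a * w) / (1 - w)) (fun w hw => ?_)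
      fun w hw => upperHalf_of_unitBall ha (by simpa using hw)
    refine DifferentiableAt.differentiableWithinAt ?_
    have : 1 - w ≠ 0 := by
      intro h
      rw [← sub_eq_zero.1 h] at hw
      simp at hw
    fun_prop (disch := assumption)

end Harnack

/-! ### Regularity of `-1` and existence of `Ω`. -/

section Existence

variable {M : Type*} [NormedAddCommGroup M] [InnerProductSpace ℂ M]

/-- The difference of the squared norms is `4 (Im μ) Im ⟨f, f'⟩`; this is the contractivity of the
Cayley transform of a dissipative relation. -/
theorem norm_add_conj_smul_le {f f' : M} {μ : ℂ} (hμ : 0 ≤ μ.im)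
    (h : 0 ≤ (inner ℂ f f').im) : ‖f' + conj μ • f‖ ≤ ‖f' + μ • f‖ := by
  refine le_of_sq_le_sq ?_ (norm_nonneg _)
  rw [norm_add_sq (𝕜 := ℂ), norm_add_sq (𝕜 := ℂ), inner_smul_right, inner_smul_right, norm_smul,
    norm_smul, Complex.norm_conj, ← inner_conj_symm f' f]
  simp only [RCLike.re_to_complex, Complex.mul_re, Complex.conj_re, Complex.conj_im]
  nlinarith [mul_nonneg hμ h]

/-- If `F` is the resolvent at `-μ` of a dissipative relation, then the operator
`c (1 + (1 - μ) F)` with `c = (μ̄ - μ) / (μ̄ - 1)` is `1` minus a contraction. -/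
theorem norm_sq_le_two_mul_re_inner {A : LinRel M} {μ : ℂ} {F : M →L[ℂ] M} (hμ : 0 < μ.im)
    (hF : shiftInv A μ = ofOp F) (hA : IsDissipative A) (g : M) :
    ‖(((conj μ - μ) / (conj μ - 1)) • (1 + (1 - μ) • F)) g‖ ^ 2 ≤
      2 * (inner ℂ g ((((conj μ - μ) / (conj μ - 1)) • (1 + (1 - μ) • F)) g)).re := by
  rw [shiftInv_eq_ofOp_iff] at hF
  have h1 : conj μ - 1 ≠ 0 := by
    intro h
    have := congrArg Complex.im h
    simp only [Complex.sub_im, Complex.conj_im, Complex.one_im, Complex.zero_im] at this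
    linarith
  have hmem := (hF (F g) (g - μ • F g)).2 (by simp)
  have h2 := norm_add_conj_smul_le hμ.le (hA _ hmem)
  simp only [sub_add_cancel] at h2
  -- With `N` the normalised operator, `g - N g` is a unimodular multiple of `f' + μ̄ f`, where `g =
  -- f' + μ f`. Expanding `‖g - N g‖² ≤ ‖g‖²` gives the claim.
  have h3 : (conj μ - 1) • (g - (((conj μ - μ) / (conj μ - 1)) • (1 + (1 - μ) • F)) g) =
      (μ - 1) • (g - μ • F g + conj μ • F g) := by
    simp only [smul_apply, add_apply, one_apply_eq_self, smul_sub, smul_add, smul_smul,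
      mul_div_cancel₀ _ h1]
    rw [← mul_assoc (conj μ - 1), mul_div_cancel₀ _ h1]
    module
  set N := ((conj μ - μ) / (conj μ - 1)) • (1 + (1 - μ) • F)
  have h4 : ‖g - N g‖ ≤ ‖g‖ := by
    have h5 := congrArg norm h3
    have h6 : ‖conj μ - 1‖ = ‖μ - 1‖ := by
      rw [← Complex.norm_conj (μ - 1)]
      simp
    rw [norm_smul, norm_smul, h6] at h5
    have h7 : 0 < ‖μ - 1‖ := h6 ▸ norm_pos_iff.2 h1
    rw [mul_left_cancel₀ h7.ne' h5]
    exact h2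
  have h5 := pow_le_pow_left₀ (norm_nonneg _) h4 2
  rw [norm_sub_sq (𝕜 := ℂ)] at h5
  simp only [RCLike.re_to_complex] at h5
  linarith

/-- With `g = f' + μ f`, the operator sends `g` to `f + f'`. As `Re ⟨f, f'⟩ ≥ 0`, both `‖f‖` and
`‖f'‖` are at most `‖f + f'‖`. The constant depends on `μ` only. -/
theorem norm_le_of_isNonneg {A : LinRel M} {μ : ℂ} {F : M →L[ℂ] M}
    (hF : shiftInv A μ = ofOp F) (hA : IsNonneg A) (g : M) :
    ‖g‖ ≤ (1 + ‖μ‖) * ‖(1 + (1 - μ) • F) g‖ := by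
  rw [shiftInv_eq_ofOp_iff] at hF
  have hmem := (hF (F g) (g - μ • F g)).2 (by simp)
  obtain ⟨-, h0⟩ := hA _ hmem
  have e : (1 + (1 - μ) • F) g = F g + (g - μ • F g) := by
    simp only [add_apply, smul_apply, one_apply_eq_self]
    module
  rw [e]
  have hg : g = (g - μ • F g) + μ • F g := by abel
  simp only at h0
  generalize F g = f at *
  generalize g - μ • f = f' at *
  have h1 := norm_add_sq (𝕜 := ℂ) f f'
  simp only [RCLike.re_to_complex] at h1
  have h2 : ‖f‖ ≤ ‖f + f'‖ := le_of_sq_le_sq (by nlinarith [sq_nonneg ‖f'‖]) (norm_nonneg _)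
  have h3 : ‖f'‖ ≤ ‖f + f'‖ := le_of_sq_le_sq (by nlinarith [sq_nonneg ‖f‖]) (norm_nonneg _)
  calc ‖g‖ ≤ ‖f'‖ + ‖μ‖ * ‖f‖ := by
        rw [hg, ← norm_smul]; exact norm_add_le _ _
    _ ≤ ‖f + f'‖ + ‖μ‖ * ‖f + f'‖ := by gcongr
    _ = _ := by ring

variable [CompleteSpace M]

theorem isUnit_of_re_inner {N : M →L[ℂ] M} {δ : ℝ} (hδ : 0 < δ)
    (h : ∀ g, δ * ‖g‖ ^ 2 ≤ (inner ℂ g (N g)).re) : IsUnit N := by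
  refine ContinuousLinearMap.isUnit_of_forall_le_norm_inner_map _ (c := ⟨δ, hδ.le⟩) hδ fun g => ?_
  rw [norm_inner_symm, mul_comm]
  exact (h g).trans (Complex.re_le_norm _)

theorem exists_mem_upperHalf_of_eventually {P : ℂ → Prop} {l : ℂ} (hl : l ∈ negAxis)
    (h : ∀ᶠ w in 𝓝 l, P w) : ∃ w ∈ upperHalf, P w := by
  have ht : Tendsto (fun t : ℝ => l + t * Complex.I) (𝓝[>] 0) (𝓝 l) := by
    have : ContinuousAt (fun t : ℝ => l + t * Complex.I) 0 := by fun_prop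
    have := this.tendsto
    simp only [Complex.ofReal_zero, zero_mul, add_zero] at this
    exact this.mono_left nhdsWithin_le_nhds
  obtain ⟨t, ht, ht0⟩ := ((ht.eventually h).and self_mem_nhdsWithin).exists
  refine ⟨_, ?_, ht⟩
  have ht0 : 0 < t := ht0
  simpa [upperHalf, hl.1] using ht0

/-- For a Stieltjes family with resolvent `F` at `-μ`, the operators `1 + (1 - μ) F(l)` are
invertible; equivalently, `-1` is a regular point of every relation of the family. -/
theorem IsStieltjesFamily.isUnit_one_add_smul {Q : ℂ → LinRel M} (h : IsStieltjesFamily Q) {μ : ℂ}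
    (hμ : μ ∈ upperHalf) {F : ℂ → M →L[ℂ] M} (hF : AnalyticOnNhd ℂ F (upperHalf ∪ negAxis))
    (hFQ : ∀ l ∈ upperHalf ∪ negAxis, shiftInv (Q l) μ = ofOp (F l)) {l : ℂ}
    (hl : l ∈ upperHalf ∪ negAxis) : IsUnit (1 + (1 - μ) • F l) := by
  have hμ' : 0 < μ.im := hμ
  set c : ℂ := (conj μ - μ) / (conj μ - 1) with hc
  have hc0 : c ≠ 0 := by
    refine div_ne_zero (fun h => ?_) fun h => ?_ <;>
    · have := congrArg Complex.im h
      simp only [Complex.sub_im, Complex.conj_im, Complex.one_im, Complex.zero_im] at this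
      linarith
  set N : ℂ → M →L[ℂ] M := fun l => c • (1 + (1 - μ) • F l) with hN
  have hNan : AnalyticOnNhd ℂ N (upperHalf ∪ negAxis) := fun l hl =>
    analyticAt_const.fun_smul (analyticAt_const.add (analyticAt_const.fun_smul (hF l hl)))
  have hNre : ∀ l ∈ upperHalf ∪ negAxis, ∀ g, ‖N l g‖ ^ 2 ≤ 2 * (inner ℂ g (N l g)).re := by
    intro l hl g
    refine norm_sq_le_two_mul_re_inner hμ' (hFQ l hl) ?_ g
    rcases hl with hl | hl
    · exact (h.nevanlinna.dissipative l hl).1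
    · exact fun p hp => (h.nonneg l hl p hp).1.ge
  suffices hu : IsUnit (N l) by
    have := hu.smul (Units.mk0 c hc0)⁻¹
    rwa [hN, Units.smul_def, Units.val_inv_eq_inv_val, Units.val_mk0, smul_smul,
      inv_mul_cancel₀ hc0, one_smul] at this
  -- Comes from chaining `‖c‖ ‖g‖ ≤ (1 + ‖μ‖) ‖N x g‖` with `‖N x g‖² ≤ 2 Re ⟨g, N x g⟩`.
  set δ : ℝ := ‖c‖ ^ 2 / (2 * (1 + ‖μ‖) ^ 2) with hδ
  have hδ0 : 0 < δ := by positivity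
  have hneg : ∀ x ∈ negAxis, ∀ g, δ * ‖g‖ ^ 2 ≤ (inner ℂ g (N x g)).re := by
    intro x hx g
    have h1 := hNre x (Or.inr hx) g
    have h2 := norm_le_of_isNonneg (hFQ x (Or.inr hx)) (h.nonneg x hx) g
    have h3 : ‖N x g‖ = ‖c‖ * ‖(1 + (1 - μ) • F x) g‖ := norm_smul _ _
    have h4 := pow_le_pow_left₀ (norm_nonneg _) h2 2
    rw [hδ, div_mul_eq_mul_div, div_le_iff₀ (by positivity)]
    calc ‖c‖ ^ 2 * ‖g‖ ^ 2 ≤ ‖c‖ ^ 2 * ((1 + ‖μ‖) * ‖(1 + (1 - μ) • F x) g‖) ^ 2 := by gcongr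
      _ = ‖N x g‖ ^ 2 * (1 + ‖μ‖) ^ 2 := by rw [h3]; ring
      _ ≤ 2 * (inner ℂ g (N x g)).re * (1 + ‖μ‖) ^ 2 := by gcongr
      _ = _ := by ring
  rcases hl with hl | hl
  swap
  · exact isUnit_of_re_inner hδ0 (hneg l hl)
  -- Any point of the negative axis would serve. Norm continuity of `N` there carries the lower
  -- bound into the upper half-plane at the cost of half of `δ`.
  have hx : (-1 : ℂ) ∈ negAxis := by simp [negAxis]
  obtain ⟨l₀, hl₀, hclose⟩ : ∃ l₀ ∈ upperHalf, ‖N l₀ - N (-1)‖ < δ / 2 := by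
    refine exists_mem_upperHalf_of_eventually hx ?_
    have := (hNan (-1) (Or.inr hx)).continuousAt.tendsto
    exact (tendsto_iff_norm_sub_tendsto_zero.1 this).eventually_lt_const (by positivity)
  have hl₀re : ∀ g, δ / 2 * ‖g‖ ^ 2 ≤ (inner ℂ g (N l₀ g)).re := by
    intro g
    have h1 : (inner ℂ g (N l₀ g)).re =
        (inner ℂ g (N (-1) g)).re + (inner ℂ g ((N l₀ - N (-1)) g)).re := by
      rw [sub_apply, inner_sub_right, Complex.sub_re]
      ring
    have h2 : |(inner ℂ g ((N l₀ - N (-1)) g)).re| ≤ δ / 2 * ‖g‖ ^ 2 :=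
      calc _ ≤ ‖inner ℂ g ((N l₀ - N (-1)) g)‖ := Complex.abs_re_le_norm _
        _ ≤ ‖g‖ * ‖(N l₀ - N (-1)) g‖ := norm_inner_le_norm _ _
        _ ≤ ‖g‖ * (δ / 2 * ‖g‖) := by
          gcongr
          exact ((N l₀ - N (-1)).le_opNorm g).trans (by gcongr)
        _ = _ := by ring
    have h3 := hneg (-1) hx g
    have h4 := neg_le_of_abs_le h2
    linarith
  -- The constant `k` is fixed before `g` is chosen, so the bound at `l` is uniform in `g` and
  -- yields invertibility.
  obtain ⟨k, hk, hharnack⟩ := harnack_upperHalf hl hl₀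
  refine isUnit_of_re_inner (δ := k * (δ / 2)) (by positivity) fun g => ?_
  have h1 := hharnack (fun w => inner ℂ g (N w g)) (fun w hw => ?_) fun w hw => ?_
  · calc k * (δ / 2) * ‖g‖ ^ 2 = k * (δ / 2 * ‖g‖ ^ 2) := by ring
      _ ≤ k * (inner ℂ g (N l₀ g)).re := by gcongr; exact hl₀re g
      _ ≤ _ := h1
  · have hd := (hNan w (Or.inl hw)).differentiableAt
    have := ((innerSL ℂ g).comp (ContinuousLinearMap.apply ℂ M g)).differentiableAt.comp w hd
    exact this.differentiableWithinAt
  · linarith [hNre w (Or.inl hw) g, sq_nonneg ‖N w g‖]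

theorem IsStieltjesFamily.exists_eq_cayley {Q : ℂ → LinRel M} (h : IsStieltjesFamily Q) {l : ℂ}
    (hl : l ∈ cutPlane) : ∃ T : M →L[ℂ] M, Q l = cayley (ofOp T) := by
  obtain ⟨μ, hμ, F, hF, hFQ⟩ := h.continuation_upper
  have key : ∀ l ∈ upperHalf ∪ negAxis, ∃ T : M →L[ℂ] M, Q l = cayley (ofOp T) := fun l hl =>
    ⟨_, eq_cayley_ofOp (hFQ l hl) (h.isUnit_one_add_smul hμ hF hFQ hl)⟩
  rcases mem_cutPlane_iff.1 hl with hl | hl | hl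
  · exact key l (Or.inl hl)
  · have hl' := conj_mem_upperHalf.2 hl
    obtain ⟨T, hT⟩ := key _ (Or.inl hl')
    -- In the lower half-plane `Q l` is the adjoint of `Q (conj l)`, hence the rotated graph of the
    -- adjoint operator.
    have h1 := h.nevanlinna.adjoint_eq _ (ne_of_gt hl')
    rw [hT, adjoint_cayley, adjoint_ofOp, Complex.conj_conj] at h1
    exact ⟨_, h1.symm⟩
  · exact key l (Or.inr hl)

theorem IsStieltjesFamily.exists_isNevanlinnaSchur {Q : ℂ → LinRel M} (h : IsStieltjesFamily Q) :
    ∃ Ω : ℂ → M →L[ℂ] M, IsNevanlinnaSchur Ω ∧ ∀ l ∈ cutPlane, Q l = stieltjesTransform Ω l := by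
  choose! T hT using fun l (hl : l ∈ cutPlane) => h.exists_eq_cayley hl
  have he : ∀ l ∈ cutPlane, Q l = stieltjesTransform (fun z => T ((z - 1) / (z + 1))) l := by
    intro l hl
    rw [stieltjesTransform_eq_cayley, mobius_symm_mobius (ne_one_of_mem_cutPlane hl)]
    exact hT l hl
  exact ⟨_, .of_isStieltjesFamily (h.congr he), he⟩

theorem isNevanlinnaSchur_iff_isStieltjesFamily (Ω : ℂ → M →L[ℂ] M) :
    IsNevanlinnaSchur Ω ↔ IsStieltjesFamily (stieltjesTransform Ω) :=
  ⟨IsNevanlinnaSchur.isStieltjesFamily, IsNevanlinnaSchur.of_isStieltjesFamily⟩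

theorem isNevanlinnaSchur_iff_isInverseStieltjesFamily (Ω : ℂ → M →L[ℂ] M) :
    IsNevanlinnaSchur Ω ↔ IsInverseStieltjesFamily (inverseStieltjesTransform Ω) := by
  rw [isNevanlinnaSchur_iff_isStieltjesFamily, isStieltjesFamily_iff_negInv,
    funext (inverseStieltjesTransform_eq_negInv Ω)]

theorem IsInverseStieltjesFamily.exists_isNevanlinnaSchur {R : ℂ → LinRel M}
    (h : IsInverseStieltjesFamily R) : ∃ Ω : ℂ → M →L[ℂ] M, IsNevanlinnaSchur Ω ∧
      ∀ l ∈ cutPlane, R l = inverseStieltjesTransform Ω l := by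
  obtain ⟨Ω, hΩ, he⟩ := h.negInv.exists_isNevanlinnaSchur
  refine ⟨Ω, hΩ, fun l hl => ?_⟩
  rw [inverseStieltjesTransform_eq_negInv, ← he l hl, negInv_negInv]

end Existence

end

theorem lemma3p2 {M : Type*} [NormedAddCommGroup M] [InnerProductSpace ℂ M] [CompleteSpace M] :
    (∀ Ω : ℂ → M →L[ℂ] M,
      (IsNevanlinnaSchur Ω ↔ IsStieltjesFamily (stieltjesTransform Ω)) ∧
      (IsNevanlinnaSchur Ω ↔ IsInverseStieltjesFamily (inverseStieltjesTransform Ω)) ∧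
      (∀ l ∈ cutPlane,
        (stieltjesTransform Ω l : Set (M × M)) =
            {p | ∃ h : M, p = ((1 - Ω ((1 + l) / (1 - l))) h, (1 + Ω ((1 + l) / (1 - l))) h)} ∧
        (inverseStieltjesTransform Ω l : Set (M × M)) =
            {p | ∃ h : M, p = ((1 + Ω ((1 + l) / (1 - l))) h, (Ω ((1 + l) / (1 - l)) - 1) h)} ∧
        inverseStieltjesTransform Ω l = LinRel.neg (LinRel.inv (stieltjesTransform Ω l)))) ∧
    (∀ Q : ℂ → LinRel M, IsStieltjesFamily Q →
      ∃ Ω : ℂ → M →L[ℂ] M, IsNevanlinnaSchur Ω ∧ ∀ l ∈ cutPlane, Q l = stieltjesTransform Ω l) ∧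
    (∀ R : ℂ → LinRel M, IsInverseStieltjesFamily R →
      ∃ Ω : ℂ → M →L[ℂ] M, IsNevanlinnaSchur Ω ∧
        ∀ l ∈ cutPlane, R l = inverseStieltjesTransform Ω l) ∧
    (∀ Q : ℂ → LinRel M, IsStieltjesFamily Q ↔
      IsInverseStieltjesFamily fun l => LinRel.neg (LinRel.inv (Q l))) := by
  refine ⟨fun Ω => ⟨isNevanlinnaSchur_iff_isStieltjesFamily Ω,
    isNevanlinnaSchur_iff_isInverseStieltjesFamily Ω, fun l _ => ⟨coe_stieltjesTransform Ω l,
      coe_inverseStieltjesTransform Ω l, inverseStieltjesTransform_eq_negInv Ω l⟩⟩,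
    fun Q hQ => hQ.exists_isNevanlinnaSchur, fun R hR => hR.exists_isNevanlinnaSchur,
    isStieltjesFamily_iff_negInv⟩
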